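/- **Setting.** Let $d\in\{2,3\}$ and let $\Omega\subset\mathbb R^d$ be a polygonal/polyhedral domain divided into disjoint polygonal/polyhedral subdomains $\Omega_s$ (solid) and $\Omega_f$ (fluid) with $\overline\Omega=\overline\Omega_s\cup\overline\Omega_f$. Let $\rho=\rho_s>0$ in $\Omega_s$ and $\rho=\rho_f>0$ in $\Omega_f$, let $\mathcal A_s=\mathcal C_s^{-1}$ for a symmetric positive definite constant tensor $\mathcal C_s$ of order four acting on the space $\mathbb S$ of symmetric $d\times d$ matrices, and let $\mathcal A_f\tau=\frac1{2\mu_f}\bigl(\tau-\frac{\lambda_f}{d\lambda_f+2\mu_f}(\operatorname{tr}\tau)I\bigr)$ with $\mu_f,\lambda_f>0$. Let $\mathcal T_h$ be a triangulation of $\overline\Omega$ into triangles and/or convex quadrilaterals ($d=2$), respectively tetrahedra and/or parallelepipeds ($d=3$), possibly with hanging nodes, such that $\overline\Omega_s$ and $\overline\Omega_f$ are unions of elements. Let $\mathcal F_h$ be the set of its edges/faces: the interior ones are the intersections $K\cap K'$ of two distinct elements that have positive $(d-1)$-dimensional measure, the boundary ones are the edges/faces of elements contained in $\partial\Omega$;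 the boundary of every $K\in\mathcal T_h$ is the union of the set $\mathcal F(K)$ of those $F\in\mathcal F_h$ that are contained in $K$. All $F\in\mathcal F_h$ are segments ($d=2$), respectively triangles or convex quadrilaterals ($d=3$). Let $h_F$ be the diameter of $F$ and $n$ the unit normal on $\partial K$ exterior to $K$. On simplices $\mathcal P_m$ denotes polynomials of total degree at most $m$, on the other elements and faces polynomials of degree at most $m$ in each variable, with respect to a fixed affine coordinate system for each of them. For $k\ge0$ put $$\mathcal H_h=\mathcal P_k(\mathcal T_h,\mathbb S),\qquad \underline{\mathcal V}_h=\mathcal P_{k+1}(\mathcal T_h,\mathbb R^d)\times\mathcal P_{k+1}(\mathcal F_h^0,\mathbb R^d)$$ (elementwise, respectively facewise, polynomials; those in $\mathcal P_{k+1}(\mathcal F_h^0,\mathbb R^d)$ vanish on boundary faces). For $\underline v=(v,\hat v)$ let $[\![\underline v]\!]|_{\partial K}=v|_{\partial K}-\hat v|_{\partial K}$, let $(\cdot,\cdot)_{\mathcal T_h}=\sum_K(\cdot,\cdot)_K$ and $\langle w,z\rangle_{\partial\mathcal T_h}=\sum_K\sum_{F\in\mathcal F(K)}\int_F w\cdot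 z$, and $$B_h(\tau,\underline v)=(\tau,\varepsilon(v))_{\mathcal T_h}-\langle\tau n,[\![\underline v]\!]\rangle_{\partial\mathcal T_h},\qquad \varepsilon(v)=\tfrac12\bigl(\nabla v+(\nabla v)^{\mathtt t}\bigr).$$ Let $T>0$, $F\in C^0([0,T];L^2(\Omega,\mathbb R^d))$ (for instance $F\in W^{1,1}(0,T;L^2(\Omega,\mathbb R^d))$), $u^0\in L^2(\Omega,\mathbb R^d)$ and $\sigma_s^0\in L^2(\Omega_s,\mathbb S)$. Consider the semi-discrete problem: find $\sigma_h\in C^1([0,T];\mathcal H_h)$ and $\underline u_h=(u_h,\hat u_h)\in C^1([0,T];\underline{\mathcal V}_h)$ such that for all $t\in[0,T]$, $\tau\in\mathcal H_h$ and $\underline v=(v,\hat v)\in\underline{\mathcal V}_h$ $$(\rho\dot u_h,v)_{\mathcal T_h}+(\mathcal A_s\dot\sigma_h,\tau)_{\Omega_s}+(\mathcal A_f\sigma_h,\tau)_{\Omega_f}+B_h(\sigma_h,\underline v)-B_h(\tau,\underline u_h)+\Bigl\langle\tfrac{(k+1)^2}{h_F}[\![\underline u_h]\!],[\![\underline v]\!]\Bigr\rangle_{\partial\mathcal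 T_h}=(F(t),v)_{\mathcal T_h},\tag{sd}$$ with the initial conditions $$u_h(0)=\Pi_{\mathcal T}^{k+1}u^0,\qquad \sigma_h|_{\Omega_s}(0)=\Pi_{\mathcal T}^k\sigma_s^0,\tag{ic}$$ where $\Pi$ denotes $L^2$-orthogonal projection onto the respective piecewise polynomial space. **Proposition.** Problem (sd)–(ic) has a solution, and the solution is unique. Moreover, let $\hat u^0\in L^2(\mathcal F_h,\mathbb R^d)$ (for instance the trace of $u^0$ on the faces if $u^0\in H^1_0(\Omega,\mathbb R^d)$), and let $\Pi_{\mathcal F}^{k+1}$ be the $L^2$-orthogonal projection onto $\mathcal P_{k+1}(\mathcal F_h^0,\mathbb R^d)$. Then (sd)–(ic) has a solution with, in addition, $\hat u_h(0)=\Pi_{\mathcal F}^{k+1}\hat u^0$ (which is then unique) if and only if the initial data are consistent, that is, there is $\varsigma\in\mathcal H_h$ with $\varsigma|_{\Omega_s}=\Pi_{\mathcal T}^k\sigma_s^0$ such that, with $\underline w=(\Pi_{\mathcal T}^{k+1}u^0,\Pi_{\mathcal F}^{k+1}\hat u^0)$, $$(\mathcal A_f\varsigma,\tau)_{\Omega_f}+B_h(\varsigma,(0,\hat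 v))-B_h(\tau,\underline w)+\Bigl\langle\tfrac{(k+1)^2}{h_F}[\![\underline w]\!],[\![(0,\hat v)]\!]\Bigr\rangle_{\partial\mathcal T_h}=0$$ for all $\hat v\in\mathcal P_{k+1}(\mathcal F_h^0,\mathbb R^d)$ and all $\tau\in\mathcal H_h$ that vanish on $\Omega_s$. -/

import Mathlib

open Set MeasureTheory

noncomputable section

namespace FSI

/-! ### Vectors and symmetric matrices -/

/-- Euclidean space `ℝ^d`. -/
abbrev E (d : ℕ) : Type := EuclideanSpace ℝ (Fin d)

/-- The space `𝕊` of symmetric real `d × d` matrices. -/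
def Sym (d : ℕ) : Submodule ℝ (Matrix (Fin d) (Fin d) ℝ) where
  carrier := {A | A.IsSymm}
  add_mem' := fun ha hb => ha.add hb
  zero_mem' := Matrix.isSymm_zero
  smul_mem' := fun c _ ha => ha.smul c

/-- The component-wise inner product `A : B = ∑ i j, A i j * B i j`. -/
def frob {d : ℕ} (A B : Matrix (Fin d) (Fin d) ℝ) : ℝ := ∑ i, ∑ j, A i j * B i j

/-- The vector `A n`. -/
def traction {d : ℕ} (A : Matrix (Fin d) (Fin d) ℝ) (n : E d) : E d :=
  WithLp.toLp 2 (A.mulVec n.ofLp)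

/-- The linearized strain tensor `ε(v)(x) = ½ (∇v + ∇vᵀ)(x)`. -/
def strain {d : ℕ} (v : E d → E d) (x : E d) : Matrix (Fin d) (Fin d) ℝ :=
  fun i j => (1 / 2 : ℝ) *
    ((fderiv ℝ v x (EuclideanSpace.single j 1)) i + (fderiv ℝ v x (EuclideanSpace.single i 1)) j)

/-! ### Material parameters -/

/-- A symmetric positive definite constant tensor of order four, acting on `𝕊`. -/
structure ElasticityTensor (d : ℕ) where
  toLin : Sym d →ₗ[ℝ] Sym d
  symm' : ∀ A B : Sym d, 
    frob (toLin A : Matrix (Fin d) (Fin d) ℝ) B = frob (A : Matrix (Fin d) (Fin d) ℝ) (toLin B)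
  pos' : ∀ A : Sym d, A ≠ 0 → 0 < frob (toLin A : Matrix (Fin d) (Fin d) ℝ) A

theorem ElasticityTensor.injective {d : ℕ} (C : ElasticityTensor d) :
    Function.Injective C.toLin := by
  rw [injective_iff_map_eq_zero]
  intro A hA
  by_contra hne
  have h := C.pos' A hne
  rw [hA] at h
  simp [frob] at h

/-- The inverse tensor `𝒜_s = 𝒞_s⁻¹`. -/
def ElasticityTensor.inv {d : ℕ} (C : ElasticityTensor d) : Sym d →ₗ[ℝ] Sym d :=
  (LinearEquiv.ofInjectiveEndo C.toLin C.injective).symm.toLinearMap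

/-- The physical coefficients: the densities `ρ_s, ρ_f`, the tensor `𝒞_s` of Hooke's law,
the viscosity `μ_f` and the penalty parameter `λ_f`. -/
structure Material (d : ℕ) where
  rhoS : ℝ
  rhoF : ℝ
  rhoS_pos : 0 < rhoS
  rhoF_pos : 0 < rhoF
  C : ElasticityTensor d
  mu : ℝ
  lam : ℝ
  mu_pos : 0 < mu
  lam_pos : 0 < lam

/-- `𝒜_f τ = (1 / (2 μ_f)) (τ - (λ_f / (d λ_f + 2 μ_f)) (tr τ) I)`, the inverse of
`𝒞_f τ = 2 μ_f τ + λ_f (tr τ) I`. -/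
def Material.Af {d : ℕ} (P : Material d) (A : Matrix (Fin d) (Fin d) ℝ) :
    Matrix (Fin d) (Fin d) ℝ :=
  (1 / (2 * P.mu)) • (A - (P.lam / (d * P.lam + 2 * P.mu) * A.trace) • (1 : Matrix _ _ ℝ))

/-! ### Cells and their polynomial spaces -/

/-- A nondegenerate simplex in `ℝ^n`. -/
def IsSimplexSet {n : ℕ} (D : Set (Fin n → ℝ)) : Prop :=
  ∃ s : Affine.Simplex ℝ (Fin n → ℝ) n, D = convexHull ℝ (range s.points)

/-- A nondegenerate parallelotope in `ℝ^n`. -/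
def IsParallelotope {n : ℕ} (D : Set (Fin n → ℝ)) : Prop :=
  ∃ (a : Fin n → ℝ) (e : Fin n → Fin n → ℝ), LinearIndependent ℝ e ∧
    D = {x | ∃ t : Fin n → ℝ, (∀ i, t i ∈ Icc (0 : ℝ) 1) ∧ x = a + ∑ i, t i • e i}

/-- A (convex, nondegenerate) quadrilateral in the plane. -/
def IsQuadrilateral {n : ℕ} (D : Set (Fin n → ℝ)) : Prop :=
  n = 2 ∧ (interior D).Nonempty ∧
    ∃ p : Fin 4 → Fin n → ℝ, ConvexIndependent ℝ p ∧ D = convexHull ℝ (range p)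

/-- A cell of dimension `n` in `ℝ^d`: the image, under an injective affine map
`t ↦ origin + ∑ i, t i • frame i`, of a simplex (`tensor = false`) or of a parallelotope or
quadrilateral (`tensor = true`). The coordinates `t` are the variables with respect to which
polynomial degrees on the cell are measured. On simplices their choice is immaterial. On the other
cells both the Cartesian variables and the variables along the edges can be chosen. -/
structure Cell (d n : ℕ) where
  origin : E d
  frame : Fin n → E d
  frame_indep : LinearIndependent ℝ frame
  ref : Set (Fin n → ℝ)
  tensor : Bool
  shape_simplex : tensor = false → IsSimplexSet ref
  shape_tensor : tensor = true → IsParallelotope ref ∨ IsQuadrilateral ref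

namespace Cell

variable {d n : ℕ}

/-- The affine parametrization of (the affine span of) the cell. -/
def param (c : Cell d n) (t : Fin n → ℝ) : E d := c.origin + ∑ i, t i • c.frame i

/-- The cell as a closed subset of `ℝ^d`. -/
def carrier (c : Cell d n) : Set (E d) := c.param '' c.ref

/-- Polynomials of total degree at most `m` (simplices), respectively of degree at most `m` in each
variable (other cells). -/
def polys (c : Cell d n) (m : ℕ) : Submodule ℝ (MvPolynomial (Fin n) ℝ) :=
  if c.tensor = true then MvPolynomial.restrictDegree (Fin n) ℝ m
  else MvPolynomial.restrictTotalDegree (Fin n) ℝ m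

/-- `𝒫_m(K)` for a full-dimensional cell `K`. A polynomial on `K` is identified with the polynomial
function on `ℝ^d` that extends it. -/
def elemPoly (c : Cell d d) (m : ℕ) : Submodule ℝ (E d → ℝ) where
  carrier := {v | ∃ p ∈ c.polys m, ∀ t, v (c.param t) = MvPolynomial.eval t p}
  add_mem' := by
    rintro v w ⟨p, hp, hv⟩ ⟨q, hq, hw⟩
    exact ⟨p + q, add_mem hp hq, fun t => by simp [hv, hw]⟩
  zero_mem' := ⟨0, zero_mem _, fun t => by simp⟩
  smul_mem' := by
    rintro a v ⟨p, hp, hv⟩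
    exact ⟨a • p, Submodule.smul_mem _ _ hp, fun t => by simp [hv, MvPolynomial.smul_eval]⟩

/-- `𝒫_m(F)` for a face `F`. A function on `F` is identified with its extension by zero. -/
def facePoly (c : Cell d n) (m : ℕ) : Submodule ℝ (E d → ℝ) where
  carrier := {v | (∃ p ∈ c.polys m, ∀ t ∈ c.ref, v (c.param t) = MvPolynomial.eval t p) ∧
    ∀ x, x ∉ c.carrier → v x = 0}
  add_mem' := by
    rintro v w ⟨⟨p, hp, hv⟩, hv0⟩ ⟨⟨q, hq, hw⟩, hw0⟩
    exact ⟨⟨p + q, add_mem hp hq, fun t ht => by simp [hv t ht, hw t ht]⟩,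
      fun x hx => by simp [hv0 x hx, hw0 x hx]⟩
  zero_mem' := ⟨⟨0, zero_mem _, fun t _ => by simp⟩, fun _ _ => rfl⟩
  smul_mem' := by
    rintro a v ⟨⟨p, hp, hv⟩, hv0⟩
    exact ⟨⟨a • p, Submodule.smul_mem _ _ hp,
      fun t ht => by simp [hv t ht, MvPolynomial.smul_eval]⟩, fun x hx => by simp [hv0 x hx]⟩

end Cell

/-! ### Domain and triangulation -/

/-- A bounded domain `Ω` of `ℝ^d` divided into a solid part `Ω_s` and a fluid part `Ω_f` that meet
along the interface `closure Ω_s ∩ closure Ω_f`. The parts are polygonal or polyhedral as soon as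
there is a triangulation, see `Mesh`. -/
structure Domain (d : ℕ) where
  Ω : Set (E d)
  Ωs : Set (E d)
  Ωf : Set (E d)
  connected : IsConnected Ω
  regular : interior (closure Ω) = Ω
  regular_s : interior (closure Ωs) = Ωs
  regular_f : interior (closure Ωf) = Ωf
  disjoint : Disjoint Ωs Ωf
  closure_union : closure Ωs ∪ closure Ωf = closure Ω

/-- `F` is an interior face of the family `elem` of cells: the intersection of two distinct
elements, of positive `(d-1)`-dimensional measure. -/
def IsInteriorFace {d N : ℕ} (elem : Fin N → Cell d d) (F : Set (E d)) : Prop :=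
  (∃ K L, K ≠ L ∧ F = (elem K).carrier ∩ (elem L).carrier) ∧
    0 < Measure.euclideanHausdorffMeasure (d - 1) F

/-- `F` is a boundary face of the family `elem` of cells: a facet of an element, contained in the
boundary of `Ω`. -/
def IsBoundaryFace {d N : ℕ} (Ω : Set (E d)) (elem : Fin N → Cell d d) (F : Set (E d)) : Prop :=
  (∃ K, IsExposed ℝ (elem K).carrier F) ∧ F ⊆ frontier Ω ∧
    0 < Measure.euclideanHausdorffMeasure (d - 1) F

/-- A triangulation `𝒯_h` of `closure Ω`, possibly with hanging nodes, aligned with the interface,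
together with its set `ℱ_h` of interior and boundary faces. -/
structure Mesh {d : ℕ} (D : Domain d) where
  N : ℕ
  elem : Fin N → Cell d d
  disjoint_interior : ∀ K L, K ≠ L →
    Disjoint (interior (elem K).carrier) (interior (elem L).carrier)
  aligned : ∀ K, (elem K).carrier ⊆ closure D.Ωs ∨ (elem K).carrier ⊆ closure D.Ωf
  cover_s : closure D.Ωs = ⋃ K, ⋃ (_ : (elem K).carrier ⊆ closure D.Ωs), (elem K).carrier
  cover_f : closure D.Ωf = ⋃ K, ⋃ (_ : (elem K).carrier ⊆ closure D.Ωf), (elem K).carrier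
  nF : ℕ
  face : Fin nF → Cell d (d - 1)
  face_injective : Function.Injective fun F => (face F).carrier
  face_range : (range fun F => (face F).carrier) =
    {F | IsInteriorFace elem F ∨ IsBoundaryFace D.Ω elem F}
  face_cover : ∀ K, frontier (elem K).carrier =
    ⋃ F, ⋃ (_ : (face F).carrier ⊆ (elem K).carrier), (face F).carrier

/-- The unit normal vector on the face `F` of the convex set `K`, oriented towards the exterior
of `K`. -/
def outwardNormal {d : ℕ} (K F : Set (E d)) : E d :=
  Classical.epsilon fun n : E d => ‖n‖ = 1 ∧ ∀ x ∈ F, ∀ y ∈ K, inner ℝ n (y - x) ≤ 0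

namespace Mesh

variable {d : ℕ} {D : Domain d} (M : Mesh D)

/-- `𝒯_h^s`. -/
def solid : Finset (Fin M.N) :=
  open Classical in Finset.univ.filter fun K => (M.elem K).carrier ⊆ closure D.Ωs

/-- `𝒯_h^f`. -/
def fluid : Finset (Fin M.N) :=
  open Classical in Finset.univ.filter fun K => (M.elem K).carrier ⊆ closure D.Ωf

/-- `ℱ(K)`: the faces composing the boundary of the element `K`. -/
def facesOf (K : Fin M.N) : Finset (Fin M.nF) :=
  open Classical in Finset.univ.filter fun F => (M.face F).carrier ⊆ (M.elem K).carrier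

/-- The integral over the element `K`. -/
def intK (K : Fin M.N) (g : E d → ℝ) : ℝ := ∫ x in (M.elem K).carrier, g x

/-- The surface integral over the face `F`. -/
def intF (F : Fin M.nF) (g : E d → ℝ) : ℝ :=
  ∫ x in (M.face F).carrier, g x ∂(Measure.euclideanHausdorffMeasure (d - 1))

/-- The diameter `h_F`. -/
def hF (F : Fin M.nF) : ℝ := Metric.diam (M.face F).carrier

/-- The outward unit normal `n_K` on the face `F`. -/
def normal (K : Fin M.N) (F : Fin M.nF) : E d :=
  outwardNormal (M.elem K).carrier (M.face F).carrier

/-- `𝒫_m(𝒯_h, ℝ^d)`. -/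
def brokenVec (m : ℕ) : Submodule ℝ (Fin M.N → E d → E d) where
  carrier := {v | ∀ K i, (fun x => v K x i) ∈ (M.elem K).elemPoly m}
  add_mem' := fun hv hw K i => add_mem (hv K i) (hw K i)
  zero_mem' := fun K _ => zero_mem ((M.elem K).elemPoly m)
  smul_mem' := fun a _ hv K i => Submodule.smul_mem _ a (hv K i)

/-- `𝒫_m(𝒯_h, 𝕊)`. -/
def brokenSym (m : ℕ) : Submodule ℝ (Fin M.N → E d → Sym d) where
  carrier := {v | ∀ K i j,
    (fun x => (v K x : Matrix (Fin d) (Fin d) ℝ) i j) ∈ (M.elem K).elemPoly m}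
  add_mem' := fun hv hw K i j => add_mem (hv K i j) (hw K i j)
  zero_mem' := fun K _ _ => zero_mem ((M.elem K).elemPoly m)
  smul_mem' := fun a _ hv K i j => Submodule.smul_mem _ a (hv K i j)

/-- `𝒫_m(ℱ_h⁰, ℝ^d)`: single-valued piecewise polynomials on the skeleton that vanish on the
boundary faces. -/
def traceVec (m : ℕ) : Submodule ℝ (Fin M.nF → E d → E d) where
  carrier := {v | (∀ F i, (fun x => v F x i) ∈ (M.face F).facePoly m) ∧
    ∀ F, IsBoundaryFace D.Ω M.elem (M.face F).carrier → v F = 0}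
  add_mem' := fun hv hw => ⟨fun F i => add_mem (hv.1 F i) (hw.1 F i),
    fun F hF => by simp [hv.2 F hF, hw.2 F hF]⟩
  zero_mem' := ⟨fun F _ => zero_mem ((M.face F).facePoly m), fun _ _ => rfl⟩
  smul_mem' := fun a _ hv => ⟨fun F i => Submodule.smul_mem _ a (hv.1 F i),
    fun F hF => by simp [hv.2 F hF]⟩

/-- `⟨w₁, w₂⟩_{∂𝒯_h}` for functions on `∂𝒯_h` given on each pair `(K, F)`, `F ∈ ℱ(K)`. -/
def pairing (w₁ w₂ : Fin M.N → Fin M.nF → E d → E d) : ℝ :=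
  ∑ K, ∑ F ∈ M.facesOf K, M.intF F fun x => inner ℝ (w₁ K F x) (w₂ K F x)

/-- The jump `⟦(v, v̂)⟧|_{∂K} = v|_{∂K} - v̂|_{∂K}`. -/
def jump (v : Fin M.N → E d → E d) (vh : Fin M.nF → E d → E d) :
    Fin M.N → Fin M.nF → E d → E d :=
  fun K F x => v K x - vh F x

/-- The normal component `τ n` on `∂𝒯_h`. -/
def normalTrace (τ : Fin M.N → E d → Sym d) : Fin M.N → Fin M.nF → E d → E d :=
  fun K F x => traction (τ K x) (M.normal K F)

/-- `B_h(τ, (v, v̂)) = (τ, ε(v))_{𝒯_h} - ⟨τ n, ⟦(v, v̂)⟧⟩_{∂𝒯_h}`. -/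
def B (τ : Fin M.N → E d → Sym d) (v : Fin M.N → E d → E d)
    (vh : Fin M.nF → E d → E d) : ℝ :=
  (∑ K, M.intK K fun x => frob (τ K x) (strain (v K) x))
    - M.pairing (M.normalTrace τ) (M.jump v vh)

/-- `⟨((k+1)²/h_ℱ) ⟦(u, û)⟧, ⟦(v, v̂)⟧⟩_{∂𝒯_h}`. -/
def stab (k : ℕ) (u : Fin M.N → E d → E d) (uh : Fin M.nF → E d → E d)
    (v : Fin M.N → E d → E d) (vh : Fin M.nF → E d → E d) : ℝ :=
  M.pairing (fun K F x => (((k : ℝ) + 1) ^ 2 / M.hF F) • M.jump u uh K F x) (M.jump v vh)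

/-- The form `(ρ u, v)_{𝒯_h}`. -/
def massU (P : Material d) (u v : Fin M.N → E d → E d) : ℝ :=
  ∑ K, (open Classical in if K ∈ M.solid then P.rhoS else P.rhoF) *
    M.intK K fun x => inner ℝ (u K x) (v K x)

/-- The form `(𝒜_s σ, τ)_{Ω_s}`. -/
def formS (P : Material d) (σ τ : Fin M.N → E d → Sym d) : ℝ :=
  ∑ K ∈ M.solid, M.intK K fun x => frob (P.C.inv (σ K x) : Matrix (Fin d) (Fin d) ℝ) (τ K x)

/-- The form `(𝒜_f σ, τ)_{Ω_f}`. -/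
def formF (P : Material d) (σ τ : Fin M.N → E d → Sym d) : ℝ :=
  ∑ K ∈ M.fluid, M.intK K fun x => frob (P.Af (σ K x)) (τ K x)

end Mesh

/-! ### The semi-discrete problem -/

/-- The curve `c` in the finite-dimensional real vector space `V` is of class `C¹` on `[0, T]` with
derivative `c'` (tested on the linear functionals, so that no norm has to be chosen). -/
def IsC1Curve {V : Type*} [AddCommGroup V] [Module ℝ V] (T : ℝ) (c c' : ℝ → V) : Prop :=
  ∀ l : Module.Dual ℝ V, ContinuousOn (fun t => l (c' t)) (Icc 0 T) ∧
    ∀ t ∈ Icc (0 : ℝ) T, HasDerivWithinAt (fun s => l (c s)) (l (c' t)) (Icc 0 T) t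

variable {d : ℕ} {D : Domain d}

/-- `(σ, (u, û)) ∈ C¹([0,T]; ℋ_h) × C¹([0,T]; 𝒱_h)` solves the semi-discrete HDG system with
source `f`. -/
def IsSolution (M : Mesh D) (P : Material d) (k : ℕ) (T : ℝ)
    (f : ℝ → Lp (E d) 2 (volume.restrict D.Ω))
    (σ : ℝ → M.brokenSym k) (u : ℝ → M.brokenVec (k + 1)) (uh : ℝ → M.traceVec (k + 1)) : Prop :=
  ∃ (σ' : ℝ → M.brokenSym k) (u' : ℝ → M.brokenVec (k + 1)) (uh' : ℝ → M.traceVec (k + 1)),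
    IsC1Curve T σ σ' ∧ IsC1Curve T u u' ∧ IsC1Curve T uh uh' ∧
    ∀ t ∈ Icc (0 : ℝ) T, ∀ (τ : M.brokenSym k) (v : M.brokenVec (k + 1))
      (vh : M.traceVec (k + 1)),
      M.massU P (u' t) v + M.formS P (σ' t) τ + M.formF P (σ t) τ
        + M.B (σ t) v vh - M.B τ (u t) (uh t) + M.stab k (u t) (uh t) v vh
      = ∑ K, M.intK K fun x => inner ℝ (f t x) ((v : Fin M.N → E d → E d) K x)

/-- `w` is the `L²`-orthogonal projection of `u₀` onto `𝒫_m(𝒯_h, ℝ^d)`. -/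
def IsVelProj (M : Mesh D) {m : ℕ} (u₀ : E d → E d) (w : M.brokenVec m) : Prop :=
  ∀ v : M.brokenVec m, ∑ K, M.intK K (fun x =>
    inner ℝ ((w : Fin M.N → E d → E d) K x - u₀ x) ((v : Fin M.N → E d → E d) K x)) = 0

/-- On `Ω_s`, `ς` is the `L²`-orthogonal projection of `σ₀` onto `𝒫_m(𝒯_h, 𝕊)`. -/
def IsStressProj (M : Mesh D) {m : ℕ} (σ₀ : E d → Sym d) (ς : M.brokenSym m) : Prop :=
  ∀ τ : M.brokenSym m, ∑ K ∈ M.solid, M.intK K (fun x =>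
    frob (((ς : Fin M.N → E d → Sym d) K x - σ₀ x : Sym d) : Matrix (Fin d) (Fin d) ℝ)
      ((τ : Fin M.N → E d → Sym d) K x)) = 0

/-- `w` is the `L²`-orthogonal projection of `û₀` onto `𝒫_m(ℱ_h⁰, ℝ^d)`. -/
def IsTraceProj (M : Mesh D) {m : ℕ} (u₀h : Fin M.nF → E d → E d) (w : M.traceVec m) : Prop :=
  ∀ v : M.traceVec m, ∑ F, M.intF F (fun x =>
    inner ℝ ((w : Fin M.nF → E d → E d) F x - u₀h F x) ((v : Fin M.nF → E d → E d) F x)) = 0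

/-- The discrete initial data `(Π u₀, Π û₀)`, `(Π σ₀)|_{Ω_s}` are consistent with the equations of
the semi-discrete system that contain no time derivative (those for the test functions
`τ` vanishing in `Ω_s` and `(0, v̂)`), for a suitable value of the fluid stress. -/
def IsConsistentData (M : Mesh D) (P : Material d) (k : ℕ) (u₀ : E d → E d) (σ₀ : E d → Sym d)
    (u₀h : Fin M.nF → E d → E d) : Prop :=
  ∃ (ς : M.brokenSym k) (w : M.brokenVec (k + 1)) (wh : M.traceVec (k + 1)),
    IsStressProj M σ₀ ς ∧ IsVelProj M u₀ w ∧ IsTraceProj M u₀h wh ∧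
    ∀ (τ : M.brokenSym k) (vh : M.traceVec (k + 1)),
      (∀ K ∈ M.solid, (τ : Fin M.N → E d → Sym d) K = 0) →
      M.formF P ς τ + M.B ς 0 vh - M.B τ w wh + M.stab k w wh 0 vh = 0

end FSI

end

noncomputable section

namespace FSI

/-! ### Linear differential equations in finite dimensions -/

/-! For the triple x = (σ, (u, û)) the problem is a linear differential-algebraic equation m(x', y)
+ a(x, y) = f(y) in a finite-dimensional space V. The form m is symmetric and positive semidefinite.
Its kernel consists of the triples with u = 0 and with σ = 0 in the solid, so the fluid stress and
the trace û are the algebraic unknowns. On the diagonal the two coupling terms B_h in a cancel; what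
remains on the kernel is the fluid energy (𝒜_f σ, σ) plus the penalty on the jump of (0, û). Hence a
is definite on ker m (`evolutionForm_definite`).

Testing with z ∈ ker m removes both the derivative and the load, so a solution stays in the space X
of all x with a(x, z) = 0 for z ∈ ker m (`constraintSpace`). Definiteness gives V = ker m ⊕ X
(`exists_sub_mem_constraintSpace`, `eq_zero_of_mem_constraintSpace`). Thus m is injective on X, with
an inverse R defined on the linear forms that vanish on ker m, and the problem becomes the linear
ODE x' = R(f - a x) in X (`exists_dae_solution`, `dae_unique`).

The initial conditions prescribe u(0) and the solid part of σ(0), which is exactly the information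
in m x(0). One and only one point of X has these values, whence existence and uniqueness.
Prescribing û(0) as well is possible if and only if some point of X carries all the data, and this
is the consistency condition; the source does not enter it, since the load vanishes on ker m. -/

theorem exists_linear_ode_solution {G : Type*} [NormedAddCommGroup G] [NormedSpace ℝ G]
    [CompleteSpace G] {T : ℝ} (hT : 0 ≤ T) (A : G →L[ℝ] G) {g : ℝ → G}
    (hg : ContinuousOn g (Icc 0 T)) (x₀ : G) :
    ∃ x : ℝ → G, x 0 = x₀ ∧ ∀ t ∈ Icc 0 T, HasDerivWithinAt x (A (x t) + g t) (Icc 0 T) t := by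
  let _ : NormedAlgebra ℚ (G →L[ℝ] G) := NormedAlgebra.restrictScalars ℚ ℝ _
  -- The source is extended by its end values, so that the integrand below is continuous on the
  -- whole line.
  set g' : ℝ → G := IccExtend hT ((Icc 0 T).domRestrict g) with hg'
  have hgc : Continuous g' := (continuousOn_iff_continuous_domRestrict.1 hg).Icc_extend'
  have hgg : ∀ t ∈ Icc 0 T, g' t = g t := fun t ht => by
    rw [hg', IccExtend_of_mem _ _ ht]; rfl
  let U : ℝ → G →L[ℝ] G := fun t => NormedSpace.exp (t • A)
  have hU : ∀ t, HasDerivAt U (A * U t) t := fun t => hasDerivAt_exp_smul_const' A t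
  have hUc : Continuous U := continuous_iff_continuousAt.2 fun t => (hU t).continuousAt
  have hinv : ∀ t, U t * U (-t) = 1 := fun t => by
    have hc : Commute (t • A) ((-t) • A) :=
      ((Commute.refl A).smul_left t).smul_right (-t)
    have h : U t * U (-t) = NormedSpace.exp (t • A + (-t) • A) :=
      (NormedSpace.exp_add_of_commute hc).symm
    rw [h, ← add_smul]; simp
  -- Variation of constants: x(t) = exp(tA) (x₀ + ∫₀ᵗ exp(-sA) g(s) ds).
  let F : ℝ → G := fun s => U (-s) (g' s)
  have hF : Continuous F := (hUc.comp continuous_neg).clm_apply hgc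
  let y : ℝ → G := fun t => x₀ + ∫ s in (0 : ℝ)..t, F s
  have hy : ∀ t, HasDerivAt y (F t) t := fun t =>
    (intervalIntegral.integral_hasDerivAt_right (hF.intervalIntegrable _ _)
      hF.stronglyMeasurable.stronglyMeasurableAtFilter hF.continuousAt).const_add x₀
  refine ⟨fun t => U t (y t), by simp [U, y], fun t ht => ?_⟩
  have h := ((hU t).clm_apply (hy t)).hasDerivWithinAt (s := Icc 0 T)
  convert h using 1
  have h1 : U t (F t) = g t := by
    have := congrArg (fun L : G →L[ℝ] G => L (g' t)) (hinv t)
    simpa [F, hgg t ht] using this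
  rw [h1]; rfl

theorem linear_ode_unique {G : Type*} [NormedAddCommGroup G] [NormedSpace ℝ G]
    {T : ℝ} (A : G →L[ℝ] G) (g : ℝ → G) {x y : ℝ → G}
    (hx : ∀ t ∈ Icc 0 T, HasDerivWithinAt x (A (x t) + g t) (Icc 0 T) t)
    (hy : ∀ t ∈ Icc 0 T, HasDerivWithinAt y (A (y t) + g t) (Icc 0 T) t) (h0 : x 0 = y 0) :
    EqOn x y (Icc 0 T) := by
  -- The Grönwall-type uniqueness theorem asks for right derivatives within `Ici t` at the points t
  -- < T.
  have key : ∀ z : ℝ → G, (∀ t ∈ Icc 0 T, HasDerivWithinAt z (A (z t) + g t) (Icc 0 T) t) →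
      ContinuousOn z (Icc 0 T) ∧
        ∀ t ∈ Ico 0 T, HasDerivWithinAt z (A (z t) + g t) (Ici t) t := fun z hz =>
    ⟨fun t ht => (hz t ht).continuousWithinAt, fun t ht =>
      ((hz t ⟨ht.1, ht.2.le⟩).mono (Icc_subset_Icc_left ht.1)).mono_of_mem_nhdsWithin
        (Icc_mem_nhdsGE ht.2)⟩
  refine ODE_solution_unique_of_mem_Icc_right (v := fun t w => A w + g t) (s := fun _ => univ)
    (K := ‖A‖₊) (fun t _ => ?_) (key x hx).1 (key x hx).2 (fun _ _ => trivial)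
    (key y hy).1 (key y hy).2 (fun _ _ => trivial) h0
  exact (A.lipschitz.add (LipschitzWith.const (g t))).lipschitzOnWith.weaken (by simp)

/-! ### Curves of class `C¹` in finite-dimensional spaces without a norm -/

section Curves

variable {V W : Type*} [AddCommGroup V] [Module ℝ V] [AddCommGroup W] [Module ℝ W]
  {T : ℝ} {c c' : ℝ → V}

theorem IsC1Curve.map (h : IsC1Curve T c c') (L : V →ₗ[ℝ] W) :
    IsC1Curve T (fun t => L (c t)) (fun t => L (c' t)) := fun l => h (l.comp L)

theorem IsC1Curve.prodMk {e e' : ℝ → W} (h : IsC1Curve T c c') (h' : IsC1Curve T e e') :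
    IsC1Curve T (fun t => (c t, e t)) (fun t => (c' t, e' t)) := by
  intro l
  have key : ∀ x y, l (x, y) = l.comp (LinearMap.inl ℝ V W) x + l.comp (LinearMap.inr ℝ V W) y := by
    intro x y
    simp [← map_add]
  simp only [key]
  exact ⟨(h _).1.add (h' _).1, fun t ht => ((h _).2 t ht).add ((h' _).2 t ht)⟩

variable {n : ℕ}

theorem isC1Curve_of_hasDerivWithinAt (e : V ≃ₗ[ℝ] (Fin n → ℝ)) {x x' : ℝ → Fin n → ℝ}
    (hx : ∀ t ∈ Icc 0 T, HasDerivWithinAt x (x' t) (Icc 0 T) t)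
    (hx' : ContinuousOn x' (Icc 0 T)) :
    IsC1Curve T (fun t => e.symm (x t)) (fun t => e.symm (x' t)) := by
  intro l
  let L : (Fin n → ℝ) →L[ℝ] ℝ := LinearMap.toContinuousLinearMap (l.comp e.symm.toLinearMap)
  exact ⟨L.continuous.comp_continuousOn hx', fun t ht =>
    L.hasFDerivAt.comp_hasDerivWithinAt t (hx t ht)⟩

theorem IsC1Curve.hasDerivWithinAt (h : IsC1Curve T c c') (L : V →ₗ[ℝ] (Fin n → ℝ)) {t : ℝ}
    (ht : t ∈ Icc 0 T) :
    HasDerivWithinAt (fun s => L (c s)) (L (c' t)) (Icc 0 T) t :=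
  hasDerivWithinAt_pi.2 fun i => (h ((LinearMap.proj i).comp L)).2 t ht

/-- A family of linear forms that is continuous at each vector is continuous after application of
any linear map. -/
theorem continuousOn_linear_comp [FiniteDimensional ℝ V] {s : Set ℝ} {f : ℝ → Module.Dual ℝ V}
    (hf : ∀ y, ContinuousOn (fun t => f t y) s) (L : Module.Dual ℝ V →ₗ[ℝ] (Fin n → ℝ)) :
    ContinuousOn (fun t => L (f t)) s := by
  let b := Module.finBasis ℝ V
  have h : ∀ t, L (f t) = ∑ i, f t (b i) • L (b.coord i) := fun t => by
    conv_lhs => rw [← b.sum_dual_apply_smul_coord (f t), map_sum]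
    simp only [map_smul]
  simp only [h]
  exact continuousOn_finsetSum _ fun i _ => (hf (b i)).smul continuousOn_const

end Curves

/-! ### Linear differential-algebraic equations `m(x', y) + a(x, y) = f(y)` -/

section DAE

variable {V : Type*} [AddCommGroup V] [Module ℝ V]

/-- The vectors that satisfy the algebraic constraints contained in `m(x', y) + a(x, y) = f(y)`,
where `f` vanishes on the kernel of `m`. -/
def constraintSpace (m a : V →ₗ[ℝ] V →ₗ[ℝ] ℝ) : Submodule ℝ V where
  carrier := {x | ∀ z, m z = 0 → a x z = 0}
  add_mem' := fun hx hy z hz => by simp [hx z hz, hy z hz]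
  zero_mem' := fun z _ => by simp
  smul_mem' := fun r x hx z hz => by simp [hx z hz]

variable {m a : V →ₗ[ℝ] V →ₗ[ℝ] ℝ}

/-- A linear form that vanishes on the kernel of a symmetric form is represented by the form. -/
theorem exists_represents_of_symm [FiniteDimensional ℝ V] (hm : ∀ x y, m x y = m y x)
    (φ : Module.Dual ℝ V)
    (hφ : ∀ z, m z = 0 → φ z = 0) : ∃ x, m x = φ := by
  -- In finite dimension the annihilator of the kernel is the range of the transpose, and m is its
  -- own transpose.
  have h : φ ∈ (LinearMap.ker m).dualAnnihilator :=
    (Submodule.mem_dualAnnihilator _).2 fun z hz => hφ z hz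
  rw [LinearMap.dualAnnihilator_ker_eq_range_flip] at h
  obtain ⟨x, hx⟩ := h
  exact ⟨x, by rw [← hx]; ext y; exact hm x y⟩

/-- Definiteness makes a, restricted to ker m, injective as a map into the dual of ker m, hence
bijective by equality of dimensions. So a(x, ·) on ker m is a(z, ·) for some z ∈ ker m. Subtracting
z enforces the constraints and leaves m x unchanged. -/
theorem exists_sub_mem_constraintSpace [FiniteDimensional ℝ V]
    (ha : ∀ z, m z = 0 → a z z = 0 → z = 0) (x : V) :
    ∃ z, m z = 0 ∧ x - z ∈ constraintSpace m a := by
  let Z := LinearMap.ker m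
  let aZ : Z →ₗ[ℝ] Module.Dual ℝ Z := a.compl₁₂ Z.subtype Z.subtype
  have hinj : Function.Injective aZ := by
    rw [injective_iff_map_eq_zero]
    intro z hz
    exact Subtype.ext (ha z z.2 (LinearMap.congr_fun hz z))
  have hsurj : Function.Surjective aZ :=
    (LinearMap.injective_iff_surjective_of_finrank_eq_finrank
      Subspace.dual_finrank_eq.symm).1 hinj
  obtain ⟨z, hz⟩ := hsurj ((a x).comp Z.subtype)
  refine ⟨z, z.2, fun w hw => ?_⟩
  have := congrArg (fun φ => φ ⟨w, hw⟩) hz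
  simp only [aZ, LinearMap.compl₁₂_apply, LinearMap.comp_apply, Submodule.subtype_apply] at this
  simp [this]

theorem eq_zero_of_mem_constraintSpace (ha : ∀ z, m z = 0 → a z z = 0 → z = 0) {x : V}
    (hx : x ∈ constraintSpace m a) (hmx : m x = 0) : x = 0 :=
  ha x hmx (hx x hmx)

/-- A left inverse of `m` on the constraint space, which is a right inverse on the linear forms that
vanish on the kernel of `m`. -/
theorem exists_constraintSpace_inverse [FiniteDimensional ℝ V] (hm : ∀ x y, m x y = m y x)
    (ha : ∀ z, m z = 0 → a z z = 0 → z = 0) :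
    ∃ R : Module.Dual ℝ V →ₗ[ℝ] constraintSpace m a,
      (∀ x : constraintSpace m a, R (m x) = x) ∧
      ∀ φ : Module.Dual ℝ V, (∀ z, m z = 0 → φ z = 0) → m (R φ) = φ := by
  obtain ⟨R, hR⟩ := (m.comp (constraintSpace m a).subtype).exists_leftInverse_of_injective (by
    rw [LinearMap.ker_eq_bot']
    intro x hx
    exact Subtype.ext (eq_zero_of_mem_constraintSpace ha x.2 hx))
  have hR' : ∀ x : constraintSpace m a, R (m x) = x := fun x => LinearMap.congr_fun hR x
  refine ⟨R, hR', fun φ hφ => ?_⟩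
  -- The form is m x for some x, and x can be moved into the constraint space along ker m.
  obtain ⟨x, rfl⟩ := exists_represents_of_symm hm φ hφ
  obtain ⟨z, hz, hxz⟩ := exists_sub_mem_constraintSpace ha x
  have h : m x = m (x - z) := by rw [map_sub, hz, sub_zero]
  rw [h, hR' ⟨x - z, hxz⟩]

variable {T : ℝ} {f : ℝ → Module.Dual ℝ V}

/-- By symmetry m(x', z) = m(z, x') = 0 for z ∈ ker m, so testing with z leaves only a(x, z) = 0. -/
theorem dae_mem_constraintSpace (hm : ∀ x y, m x y = m y x)
    (hfz : ∀ t z, m z = 0 → f t z = 0) {x x' : ℝ → V}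
    (h : ∀ t ∈ Icc 0 T, ∀ y, m (x' t) y + a (x t) y = f t y) {t : ℝ} (ht : t ∈ Icc 0 T) :
    x t ∈ constraintSpace m a := fun z hz => by
  have := h t ht z
  rw [hm, hz, hfz t z hz] at this
  simpa using this

/-- The ODE x' = R(f - a x) is solved in coordinates of the constraint space, so the constraints
hold at all times by construction. -/
theorem exists_dae_solution [FiniteDimensional ℝ V] (hT : 0 ≤ T) (hm : ∀ x y, m x y = m y x)
    (ha : ∀ z, m z = 0 → a z z = 0 → z = 0)
    (hf : ∀ y, ContinuousOn (fun t => f t y) (Icc 0 T)) (hfz : ∀ t z, m z = 0 → f t z = 0)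
    {x₀ : V} (hx₀ : x₀ ∈ constraintSpace m a) :
    ∃ x x' : ℝ → V, x 0 = x₀ ∧ IsC1Curve T x x' ∧
      ∀ t ∈ Icc 0 T, ∀ y, m (x' t) y + a (x t) y = f t y := by
  obtain ⟨R, hR, hRφ⟩ := exists_constraintSpace_inverse hm ha
  let e : constraintSpace m a ≃ₗ[ℝ] (Fin (Module.finrank ℝ (constraintSpace m a)) → ℝ) :=
    (Module.finBasis ℝ (constraintSpace m a)).equivFun
  let L : constraintSpace m a →ₗ[ℝ] constraintSpace m a :=
    -(R.comp (a.comp (constraintSpace m a).subtype))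
  let A := LinearMap.toContinuousLinearMap (e.toLinearMap.comp (L.comp e.symm.toLinearMap))
  have hg := continuousOn_linear_comp hf (e.toLinearMap.comp R)
  obtain ⟨x, hx0, hx⟩ := exists_linear_ode_solution hT A hg (e ⟨x₀, hx₀⟩)
  have hxc : ContinuousOn x (Icc 0 T) := fun t ht => (hx t ht).continuousWithinAt
  have hC := (isC1Curve_of_hasDerivWithinAt e hx
    ((A.continuous.comp_continuousOn hxc).add hg)).map (constraintSpace m a).subtype
  refine ⟨_, _, by simp [hx0], hC, fun t _ y => ?_⟩
  have h1 : e.symm (A (x t) + (e.toLinearMap.comp R) (f t)) = R (f t - a (e.symm (x t))) := by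
    simp [A, L, add_comm, sub_eq_add_neg]
  -- Here the constraints are used: f - a x vanishes on ker m, so m undoes R and the original
  -- equation returns.
  have h2 := hRφ (f t - a (e.symm (x t))) fun z hz => by
    simp [hfz t z hz, (e.symm (x t)).2 z hz]
  rw [h1]
  simp only [Submodule.subtype_apply]
  rw [h2]
  simp

/-- Only m x(0) has to agree: both curves lie in the constraint space, where R recovers x from m x.
-/
theorem dae_unique [FiniteDimensional ℝ V] (hm : ∀ x y, m x y = m y x)
    (ha : ∀ z, m z = 0 → a z z = 0 → z = 0) (hfz : ∀ t z, m z = 0 → f t z = 0)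
    {x x' y y' : ℝ → V} (hx : IsC1Curve T x x') (hy : IsC1Curve T y y')
    (hxe : ∀ t ∈ Icc 0 T, ∀ w, m (x' t) w + a (x t) w = f t w)
    (hye : ∀ t ∈ Icc 0 T, ∀ w, m (y' t) w + a (y t) w = f t w)
    (h0 : m (x 0) = m (y 0)) : EqOn x y (Icc 0 T) := by
  obtain ⟨R, hR, -⟩ := exists_constraintSpace_inverse hm ha
  let e : constraintSpace m a ≃ₗ[ℝ] (Fin (Module.finrank ℝ (constraintSpace m a)) → ℝ) :=
    (Module.finBasis ℝ (constraintSpace m a)).equivFun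
  let L : constraintSpace m a →ₗ[ℝ] constraintSpace m a :=
    -(R.comp (a.comp (constraintSpace m a).subtype))
  let A := LinearMap.toContinuousLinearMap (e.toLinearMap.comp (L.comp e.symm.toLinearMap))
  have key : ∀ {z z' : ℝ → V}, IsC1Curve T z z' →
      (∀ t ∈ Icc 0 T, ∀ w, m (z' t) w + a (z t) w = f t w) →
      ∀ t ∈ Icc 0 T, HasDerivWithinAt (fun s => e (R (m (z s))))
        (A (e (R (m (z t)))) + e (R (f t))) (Icc 0 T) t := by
    intro z z' hz hze t ht
    have hmem := dae_mem_constraintSpace hm hfz hze ht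
    -- Differentiating through R ∘ m, which is defined on all of V, avoids showing that z' lies in
    -- the constraint space.
    have h := hz.hasDerivWithinAt (e.toLinearMap.comp (R.comp m)) ht
    have h1 : m (z' t) = f t - a (z t) := by
      ext w
      simp [← hze t ht w]
    have h2 : R (m (z t)) = ⟨z t, hmem⟩ := hR ⟨z t, hmem⟩
    have h3 : A (e (R (m (z t)))) + e (R (f t)) = (e.toLinearMap.comp (R.comp m)) (z' t) := by
      simp [A, L, h1, h2, sub_eq_add_neg, add_comm]
    rw [h3]
    exact h
  have heq := linear_ode_unique A (fun t => e (R (f t))) (key hx hxe) (key hy hye)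
    (by simp only [h0])
  intro t ht
  have h1 := e.injective (heq ht)
  rw [hR ⟨x t, dae_mem_constraintSpace hm hfz hxe ht⟩,
    hR ⟨y t, dae_mem_constraintSpace hm hfz hye ht⟩] at h1
  exact congrArg Subtype.val h1

end DAE

/-! ### Geometry of cells -/

theorem IsSimplexSet.props {n : ℕ} {D : Set (Fin n → ℝ)} (h : IsSimplexSet D) :
    IsCompact D ∧ Convex ℝ D ∧ (interior D).Nonempty := by
  obtain ⟨s, rfl⟩ := h
  refine ⟨(finite_range _).isCompact_convexHull (𝕜 := ℝ), convex_convexHull (𝕜 := ℝ) _, ?_⟩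
  rw [interior_convexHull_nonempty_iff_affineSpan_eq_top,
    s.independent.affineSpan_eq_top_iff_card_eq_finrank_add_one]
  simp

theorem IsParallelotope.props {n : ℕ} {D : Set (Fin n → ℝ)} (h : IsParallelotope D) :
    IsCompact D ∧ Convex ℝ D ∧ (interior D).Nonempty := by
  obtain ⟨a, e, he, rfl⟩ := h
  let b : Module.Basis (Fin n) ℝ (Fin n → ℝ) :=
    basisOfLinearIndependentOfCardEqFinrank' e he (by simp)
  have hb : ⇑b = e := coe_basisOfLinearIndependentOfCardEqFinrank' _ _ _
  have hD : {x | ∃ t : Fin n → ℝ, (∀ i, t i ∈ Icc (0 : ℝ) 1) ∧ x = a + ∑ i, t i • e i} =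
      (Homeomorph.addLeft a) '' (b.parallelepiped : Set (Fin n → ℝ)) := by
    ext x
    simp only [Module.Basis.coe_parallelepiped, mem_image, mem_ofPred_eq, hb, mem_parallelepiped_iff]
    constructor
    · rintro ⟨t, ht, rfl⟩
      exact ⟨_, ⟨t, ⟨fun i => (ht i).1, fun i => (ht i).2⟩, rfl⟩, rfl⟩
    · rintro ⟨_, ⟨t, ht, rfl⟩, rfl⟩
      exact ⟨t, fun i => ⟨ht.1 i, ht.2 i⟩, rfl⟩
  rw [hD]
  refine ⟨b.parallelepiped.isCompact.image (Homeomorph.addLeft a).continuous, ?_, ?_⟩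
  · have : Convex ℝ (b.parallelepiped : Set (Fin n → ℝ)) := by
      rw [Module.Basis.coe_parallelepiped, parallelepiped_eq_convexHull]
      exact convex_convexHull (𝕜 := ℝ) _
    simpa using this.translate a
  · rw [← Homeomorph.image_interior]
    exact b.parallelepiped.interior_nonempty.image _

theorem IsQuadrilateral.props {n : ℕ} {D : Set (Fin n → ℝ)} (h : IsQuadrilateral D) :
    IsCompact D ∧ Convex ℝ D ∧ (interior D).Nonempty := by
  obtain ⟨-, hi, p, -, rfl⟩ := h
  exact ⟨(finite_range _).isCompact_convexHull (𝕜 := ℝ), convex_convexHull (𝕜 := ℝ) _, hi⟩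

theorem _root_.MvPolynomial.eq_zero_of_eval_eq_zero_on_open {n : ℕ} {U : Set (Fin n → ℝ)}
    (hU : (interior U).Nonempty) {p : MvPolynomial (Fin n) ℝ}
    (hp : ∀ t ∈ U, MvPolynomial.eval t p = 0) : p = 0 := by
  obtain ⟨x, hx⟩ := hU
  obtain ⟨ε, hε, hball⟩ := Metric.isOpen_iff.1 isOpen_interior x hx
  -- A ball of the sup norm is a product of intervals, and a polynomial vanishing on a product of
  -- infinite sets is zero.
  refine MvPolynomial.funext_set (fun i => Metric.ball (x i) ε) (fun i => ?_) fun t ht => ?_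
  · rw [Real.ball_eq_Ioo]
    exact Ioo_infinite (by linarith)
  · rw [map_zero]
    exact hp t (interior_subset (hball (by rwa [ball_pi _ hε])))

namespace Cell

variable {d n : ℕ} (c : Cell d n)

theorem ref_props : IsCompact c.ref ∧ Convex ℝ c.ref ∧ (interior c.ref).Nonempty := by
  cases h : c.tensor
  · exact (c.shape_simplex h).props
  · exact (c.shape_tensor h).elim IsParallelotope.props IsQuadrilateral.props

/-- The linear part of the parametrization. -/
def linear : (Fin n → ℝ) →ₗ[ℝ] E d := Fintype.linearCombination ℝ c.frame

theorem param_eq (t : Fin n → ℝ) : c.param t = c.origin + c.linear t := rfl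

theorem linear_injective : Function.Injective c.linear :=
  (LinearIndependent.fintypeLinearCombination_injective) c.frame_indep

theorem param_injective : Function.Injective c.param := fun _ _ h =>
  c.linear_injective (add_left_cancel h)

theorem continuous_param : Continuous c.param :=
  continuous_const.add c.linear.continuous_of_finiteDimensional

/-- A linear left inverse of the linear part of the parametrization. -/
def coordLinear : E d →ₗ[ℝ] (Fin n → ℝ) :=
  Classical.choose (c.linear.exists_leftInverse_of_injective
    (LinearMap.ker_eq_bot.2 c.linear_injective))

/-- Affine coordinates on the cell, extended to the whole space. -/
def coord (x : E d) : Fin n → ℝ := c.coordLinear (x - c.origin)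

theorem coord_param (t : Fin n → ℝ) : c.coord (c.param t) = t := by
  have h := Classical.choose_spec (c.linear.exists_leftInverse_of_injective
    (LinearMap.ker_eq_bot.2 c.linear_injective))
  rw [coord, param_eq, add_sub_cancel_left]
  exact LinearMap.congr_fun h t

theorem contDiff_eval (p : MvPolynomial (Fin n) ℝ) :
    ContDiff ℝ 1 fun t : Fin n → ℝ => MvPolynomial.eval t p := by
  induction p using MvPolynomial.induction_on with
  | C a => simpa using contDiff_const
  | add p q hp hq => simpa using hp.add hq
  | mul_X p i hp => simpa using hp.mul (contDiff_apply ℝ ℝ i)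

theorem contDiff_eval_coord (p : MvPolynomial (Fin n) ℝ) :
    ContDiff ℝ 1 fun x => MvPolynomial.eval (c.coord x) p :=
  (contDiff_eval p).comp ((LinearMap.toContinuousLinearMap c.coordLinear).contDiff.comp
    (contDiff_id.sub contDiff_const))

theorem isCompact_carrier : IsCompact c.carrier := c.ref_props.1.image c.continuous_param

theorem continuousOn_of_mem_facePoly {m : ℕ} {v : E d → ℝ} (hv : v ∈ c.facePoly m) :
    ContinuousOn v c.carrier := by
  obtain ⟨⟨p, -, hp⟩, -⟩ := hv
  refine (c.contDiff_eval_coord p).continuous.continuousOn.congr ?_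
  rintro _ ⟨t, ht, rfl⟩
  simp only [hp t ht, coord_param]

theorem finiteDimensional_polys (m : ℕ) : FiniteDimensional ℝ (c.polys m) := by
  have h : c.polys m ≤ MvPolynomial.restrictDegree (Fin n) ℝ m := by
    unfold polys
    split_ifs
    · exact le_rfl
    · exact MvPolynomial.restrictTotalDegree_le_restrictDegree ..
  exact Submodule.finiteDimensional_of_le h

open Classical in
/-- The polynomials in the coordinates of the cell, restricted to a set and extended by zero. -/
def extendPoly (s : Set (E d)) : MvPolynomial (Fin n) ℝ →ₗ[ℝ] (E d → ℝ) where
  toFun p x := if x ∈ s then MvPolynomial.eval (c.coord x) p else 0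
  map_add' p q := by ext x; by_cases h : x ∈ s <;> simp [h]
  map_smul' a p := by ext x; by_cases h : x ∈ s <;> simp [h, MvPolynomial.smul_eval]

theorem finiteDimensional_facePoly (m : ℕ) : FiniteDimensional ℝ (c.facePoly m) := by
  have := c.finiteDimensional_polys m
  refine Submodule.finiteDimensional_of_le
    (S₂ := (c.polys m).map (c.extendPoly c.carrier)) ?_
  rintro v ⟨⟨p, hp, hv⟩, hv0⟩
  refine ⟨p, hp, ?_⟩
  ext x
  by_cases hx : x ∈ c.carrier
  · obtain ⟨t, ht, rfl⟩ := id hx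
    simp [extendPoly, hx, hv t ht, coord_param]
  · simp [extendPoly, hx, hv0 x hx]

/-! ### The surface measure on a cell -/

/-- An injective affine map scales n-dimensional measure by a positive constant, its Jacobian. This
transfers finiteness and null sets between the surface measure on the cell and Lebesgue measure on
the reference set. -/
theorem exists_measure_image : ∃ C : ℝ, 0 < C ∧ ∀ s : Set (Fin n → ℝ),
    Measure.euclideanHausdorffMeasure n (c.param '' s) = ENNReal.ofReal C * volume s := by
  let e := EuclideanSpace.equiv (Fin n) ℝ
  let f : EuclideanSpace ℝ (Fin n) →ₗ[ℝ] E d := c.linear.comp e.toLinearEquiv.toLinearMap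
  have hf : Function.Injective f := c.linear_injective.comp e.injective
  refine ⟨f.normDet, ?_, fun s => ?_⟩
  · exact lt_of_le_of_ne f.normDet_nonneg (Ne.symm fun h => by
      rw [LinearMap.normDet_eq_zero_iff_ker_ne_bot] at h
      exact h (LinearMap.ker_eq_bot.2 hf))
  · have h1 : c.param '' s = (fun x => c.origin + x) '' (f '' (e.symm '' s)) := by
      simp only [image_image]
      refine image_congr fun t _ => ?_
      simp [f, param_eq]
    rw [h1,
      (isometry_add_left c.origin : Isometry fun x => c.origin + x).euclideanHausdorffMeasure_image]
    have h2 := f.euclideanHausdorffMeasure_image_eq_normDet_mul_volume (e.symm '' s)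
    rw [finrank_euclideanSpace_fin] at h2
    rw [h2]
    congr 1
    rw [←
      (EuclideanSpace.volume_preserving_symm_measurableEquiv_toLp (Fin n)).measure_preimage_equiv s]
    congr 1
    exact e.toEquiv.symm.image_eq_preimage_symm s

theorem measure_carrier_lt_top :
    Measure.euclideanHausdorffMeasure n c.carrier < ⊤ := by
  obtain ⟨C, -, hC⟩ := c.exists_measure_image
  rw [carrier, hC]
  exact ENNReal.mul_lt_top ENNReal.ofReal_lt_top c.ref_props.1.measure_lt_top

theorem integrableOn_carrier {g : E d → ℝ} (hg : ContinuousOn g c.carrier) :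
    IntegrableOn g c.carrier (Measure.euclideanHausdorffMeasure n) :=
  hg.integrableOn_of_subset_isCompact c.isCompact_carrier c.isCompact_carrier.measurableSet
    Subset.rfl c.measure_carrier_lt_top.ne

/-- Where g ∘ `c.param` is nonzero in the interior of the reference set, it is so on an open set of
positive measure, which is excluded. The remaining points are limits of interior points, because the
reference set is convex with nonempty interior. -/
theorem eq_zero_of_integral_eq_zero {g : E d → ℝ} (hg : ContinuousOn g c.carrier)
    (hg0 : ∀ x, 0 ≤ g x)
    (hint : ∫ x in c.carrier, g x ∂(Measure.euclideanHausdorffMeasure n) = 0) :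
    ∀ x ∈ c.carrier, g x = 0 := by
  obtain ⟨hcomp, hconv, hne⟩ := c.ref_props
  have hae := (setIntegral_eq_zero_iff_of_nonneg_ae (ae_of_all _ hg0)
    (c.integrableOn_carrier hg)).1 hint
  have hcont : ContinuousOn (fun t => g (c.param t)) c.ref :=
    hg.comp c.continuous_param.continuousOn fun t ht => mem_image_of_mem _ ht
  have hopen : IsOpen (interior c.ref ∩ (fun t => g (c.param t)) ⁻¹' {0}ᶜ) :=
    (hcont.mono interior_subset).isOpen_inter_preimage isOpen_interior isOpen_compl_singleton
  have hzero : ∀ t ∈ interior c.ref, g (c.param t) = 0 := by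
    by_contra! h
    obtain ⟨t, ht, htne⟩ := h
    have hpos := hopen.measure_pos volume ⟨t, ht, htne⟩
    obtain ⟨C, hC0, hC⟩ := c.exists_measure_image
    have h1 : Measure.euclideanHausdorffMeasure n
        (c.param '' (interior c.ref ∩ (fun t => g (c.param t)) ⁻¹' {0}ᶜ)) = 0 := by
      rw [Filter.EventuallyEq, ae_restrict_iff' c.isCompact_carrier.measurableSet, ae_iff] at hae
      refine measure_mono_null ?_ hae
      rintro _ ⟨s, ⟨hs, hsne⟩, rfl⟩
      have hmem : c.param s ∈ c.carrier := mem_image_of_mem _ (interior_subset hs)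
      simpa [hmem] using hsne
    rw [hC] at h1
    rcases mul_eq_zero.1 h1 with h2 | h2
    · exact absurd hC0 (not_lt.2 (ENNReal.ofReal_eq_zero.1 h2))
    · exact hpos.ne' h2
  rintro _ ⟨t, ht, rfl⟩
  have htc : t ∈ closure (interior c.ref) := by
    rw [hconv.closure_interior_eq_closure_of_nonempty_interior hne]
    exact subset_closure ht
  have hset : EqOn (fun t => g (c.param t)) (fun _ => 0) c.ref :=
    EqOn.of_subset_closure (s := interior c.ref) hzero hcont continuousOn_const interior_subset
      (by rw [hconv.closure_interior_eq_closure_of_nonempty_interior hne]; exact subset_closure)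
  exact hset ht

/-- The condition n > 0 matters: for a single point the diameter is 0, and the weight 1/h_F would
take the default value 0. -/
theorem diam_carrier_pos (hn : 0 < n) : 0 < Metric.diam c.carrier := by
  obtain ⟨-, -, hne⟩ := c.ref_props
  have : Nonempty (Fin n) := ⟨⟨0, hn⟩⟩
  refine Metric.diam_pos (Nontrivial.image (not_subsingleton_iff.1 fun h => ?_) c.param_injective)
    c.isCompact_carrier.isBounded
  obtain ⟨x, hx⟩ := hne
  have h1 : interior c.ref = {x} :=
    (h.anti interior_subset).eq_singleton_of_mem hx
  exact not_isOpen_singleton x (h1 ▸ isOpen_interior)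

/-! ### Full-dimensional cells -/

section Element

variable (c : Cell d d)

theorem param_coord (x : E d) : c.param (c.coord x) = x := by
  have hs : Function.Surjective c.linear :=
    (LinearMap.injective_iff_surjective_of_finrank_eq_finrank (by simp)).1 c.linear_injective
  obtain ⟨t, ht⟩ := hs (x - c.origin)
  have hx : c.param t = x := by rw [param_eq, ht, add_sub_cancel]
  rw [← hx, coord_param]

theorem convex_carrier : Convex ℝ c.carrier := by
  have h := (c.ref_props.2.1.linear_image c.linear).translate c.origin
  rwa [image_image] at h

theorem elemPoly_eq {m : ℕ} {v : E d → ℝ} (hv : v ∈ c.elemPoly m) :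
    ∃ p ∈ c.polys m, v = fun x => MvPolynomial.eval (c.coord x) p := by
  obtain ⟨p, hp, h⟩ := hv
  exact ⟨p, hp, funext fun x => by rw [← h, param_coord]⟩

theorem contDiff_of_mem_elemPoly {m : ℕ} {v : E d → ℝ} (hv : v ∈ c.elemPoly m) :
    ContDiff ℝ 1 v := by
  obtain ⟨p, -, rfl⟩ := c.elemPoly_eq hv
  exact c.contDiff_eval_coord p

/-- Discrete functions are polynomials on all of ℝ^d, so vanishing on the cell has to be upgraded to
vanishing everywhere. -/
theorem eq_zero_of_mem_elemPoly {m : ℕ} {v : E d → ℝ} (hv : v ∈ c.elemPoly m)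
    (h0 : ∀ x ∈ c.carrier, v x = 0) : v = 0 := by
  obtain ⟨p, -, rfl⟩ := c.elemPoly_eq hv
  have hp : p = 0 := MvPolynomial.eq_zero_of_eval_eq_zero_on_open c.ref_props.2.2 fun t ht => by
    simpa [coord_param] using h0 (c.param t) (mem_image_of_mem _ ht)
  ext x
  simp [hp]

theorem finiteDimensional_elemPoly (m : ℕ) : FiniteDimensional ℝ (c.elemPoly m) := by
  have := c.finiteDimensional_polys m
  refine Submodule.finiteDimensional_of_le (S₂ := (c.polys m).map (c.extendPoly univ)) ?_
  intro v hv
  obtain ⟨p, hp, rfl⟩ := c.elemPoly_eq hv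
  exact ⟨p, hp, by ext x; simp [extendPoly]⟩

/-- A closed element may touch the boundary of the domain, which lies outside the open set. The loss
is null, since the frontier of a convex set is null. -/
theorem carrier_inter_ae_eq {s : Set (E d)} (h : interior c.carrier ⊆ s) :
    (c.carrier ∩ s : Set (E d)) =ᵐ[volume] c.carrier := by
  refine (LE.le.eventuallyLE inter_subset_left).antisymm ?_
  refine ae_le_set.2 (measure_mono_null ?_ (c.convex_carrier.addHaar_frontier volume))
  rintro x ⟨hx, hxs⟩
  exact ⟨subset_closure hx, fun hi => hxs ⟨hx, h hi⟩⟩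

end Element

end Cell

/-! ### Integrals of bilinear expressions -/

/-- Expansion in a basis reduces continuity and integrability of bilinear expressions to scalar
functions, so that no norm on the spaces is needed. -/
theorem bilin_eq_sum_coord {ι G₁ G₂ : Type*} [Fintype ι] [AddCommGroup G₁] [Module ℝ G₁]
    [AddCommGroup G₂] [Module ℝ G₂] (b : Module.Basis ι ℝ G₁) (β : G₁ →ₗ[ℝ] G₂ →ₗ[ℝ] ℝ)
    (x : G₁) (y : G₂) : β x y = ∑ i, b.coord i x * β (b i) y := by
  have h := congrArg (fun z => β z y) (b.sum_repr x)
  simp only [map_sum, map_smul, LinearMap.sum_apply, LinearMap.smul_apply] at h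
  exact h.symm

theorem continuous_bilin {G₁ G₂ : Type*} [AddCommGroup G₁] [Module ℝ G₁] [TopologicalSpace G₁]
    [IsTopologicalAddGroup G₁] [ContinuousSMul ℝ G₁] [T2Space G₁] [FiniteDimensional ℝ G₁]
    [AddCommGroup G₂] [Module ℝ G₂] [TopologicalSpace G₂] [IsTopologicalAddGroup G₂]
    [ContinuousSMul ℝ G₂] [T2Space G₂] [FiniteDimensional ℝ G₂] (β : G₁ →ₗ[ℝ] G₂ →ₗ[ℝ] ℝ) :
    Continuous fun p : G₁ × G₂ => β p.1 p.2 := by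
  let b := Module.finBasis ℝ G₁
  rw [show (fun p : G₁ × G₂ => β p.1 p.2) = fun p => ∑ i, b.coord i p.1 * β (b i) p.2 from
    funext fun p => bilin_eq_sum_coord b β p.1 p.2]
  exact continuous_finsetSum _ fun i _ =>
    ((b.coord i).continuous_of_finiteDimensional.comp continuous_fst).mul
      ((β (b i)).continuous_of_finiteDimensional.comp continuous_snd)

/-- The functions that are continuous on `S`. -/
def contOn {d : ℕ} (S : Set (E d)) (G : Type*) [AddCommGroup G] [Module ℝ G] [TopologicalSpace G]
    [IsTopologicalAddGroup G] [ContinuousSMul ℝ G] : Submodule ℝ (E d → G) where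
  carrier := {g | ContinuousOn g S}
  add_mem' := fun hf hg => ContinuousOn.add hf hg
  zero_mem' := continuousOn_const
  smul_mem' := fun a _ hf => ContinuousOn.const_smul hf a

namespace Cell

variable {d n : ℕ} (c : Cell d n)
  {G₁ G₂ : Type*} [AddCommGroup G₁] [Module ℝ G₁] [FiniteDimensional ℝ G₁]
  [AddCommGroup G₂] [Module ℝ G₂] [TopologicalSpace G₂] [IsTopologicalAddGroup G₂]
  [ContinuousSMul ℝ G₂] [T2Space G₂] [FiniteDimensional ℝ G₂]

theorem integrableOn_bilin_left (β : G₁ →ₗ[ℝ] G₂ →ₗ[ℝ] ℝ) {φ : E d → G₁}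
    (hφ : ∀ l : Module.Dual ℝ G₁,
      IntegrableOn (fun x => l (φ x)) c.carrier (Measure.euclideanHausdorffMeasure n))
    (h : contOn c.carrier G₂) :
    IntegrableOn (fun x => β (φ x) (h.1 x)) c.carrier (Measure.euclideanHausdorffMeasure n) := by
  let b := Module.finBasis ℝ G₁
  rw [show (fun x => β (φ x) (h.1 x)) = fun x => ∑ i, b.coord i (φ x) * β (b i) (h.1 x) from
    funext fun x => bilin_eq_sum_coord b β (φ x) (h.1 x)]
  exact integrable_finsetSum _ fun i _ => (hφ (b.coord i)).mul_continuousOn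
    ((β (b i)).continuous_of_finiteDimensional.comp_continuousOn h.2) c.isCompact_carrier

/-- The integral over a cell of a bilinear expression in an integrable function and a continuous
function, as a linear form in the latter. -/
def loadForm (β : G₁ →ₗ[ℝ] G₂ →ₗ[ℝ] ℝ) (φ : E d → G₁)
    (hφ : ∀ l : Module.Dual ℝ G₁,
      IntegrableOn (fun x => l (φ x)) c.carrier (Measure.euclideanHausdorffMeasure n)) :
    contOn c.carrier G₂ →ₗ[ℝ] ℝ where
  toFun h := ∫ x in c.carrier, β (φ x) (h.1 x) ∂(Measure.euclideanHausdorffMeasure n)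
  map_add' h h' := by
    rw [← integral_add (c.integrableOn_bilin_left β hφ h) (c.integrableOn_bilin_left β hφ h')]
    simp
  map_smul' a h := by
    rw [RingHom.id_apply, smul_eq_mul, ← integral_const_mul]
    simp

variable [TopologicalSpace G₁] [IsTopologicalAddGroup G₁] [ContinuousSMul ℝ G₁] [T2Space G₁]

theorem integrableOn_bilin (β : G₁ →ₗ[ℝ] G₂ →ₗ[ℝ] ℝ) (g : contOn c.carrier G₁)
    (h : contOn c.carrier G₂) :
    IntegrableOn (fun x => β (g.1 x) (h.1 x)) c.carrier (Measure.euclideanHausdorffMeasure n) :=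
  c.integrableOn_carrier ((continuous_bilin β).comp_continuousOn (g.2.prodMk h.2))

/-- The integral over a cell of a bilinear expression in two continuous functions. -/
def integralForm (β : G₁ →ₗ[ℝ] G₂ →ₗ[ℝ] ℝ) :
    contOn c.carrier G₁ →ₗ[ℝ] contOn c.carrier G₂ →ₗ[ℝ] ℝ :=
  LinearMap.mk₂ ℝ (fun g h => ∫ x in c.carrier, β (g.1 x) (h.1 x)
      ∂(Measure.euclideanHausdorffMeasure n))
    (fun g g' h => by
      rw [← integral_add (c.integrableOn_bilin β g h) (c.integrableOn_bilin β g' h)]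
      simp)
    (fun a g h => by
      rw [smul_eq_mul, ← integral_const_mul]
      simp)
    (fun g h h' => by
      rw [← integral_add (c.integrableOn_bilin β g h) (c.integrableOn_bilin β g h')]
      simp)
    (fun a g h => by
      rw [smul_eq_mul, ← integral_const_mul]
      simp)

theorem integralForm_self_nonneg {β : G₁ →ₗ[ℝ] G₁ →ₗ[ℝ] ℝ} (hβ : ∀ x, 0 ≤ β x x)
    (g : contOn c.carrier G₁) : 0 ≤ c.integralForm β g g :=
  integral_nonneg fun x => hβ (g.1 x)

theorem eq_zero_of_integralForm_self {β : G₁ →ₗ[ℝ] G₁ →ₗ[ℝ] ℝ} (hβ : ∀ x, 0 ≤ β x x)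
    (hβ0 : ∀ x, β x x = 0 → x = 0) (g : contOn c.carrier G₁) (h : c.integralForm β g g = 0) :
    ∀ x ∈ c.carrier, g.1 x = 0 := fun x hx =>
  hβ0 _ (c.eq_zero_of_integral_eq_zero
    ((continuous_bilin β).comp_continuousOn (g.2.prodMk g.2)) (fun x => hβ (g.1 x)) h x hx)

theorem integral_sub_left (β : G₁ →ₗ[ℝ] G₂ →ₗ[ℝ] ℝ) {φ : E d → G₁}
    (hφ : ∀ l : Module.Dual ℝ G₁,
      IntegrableOn (fun x => l (φ x)) c.carrier (Measure.euclideanHausdorffMeasure n))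
    (g : contOn c.carrier G₁) (h : contOn c.carrier G₂) :
    ∫ x in c.carrier, β (g.1 x - φ x) (h.1 x) ∂(Measure.euclideanHausdorffMeasure n) =
      c.integralForm β g h - c.loadForm β φ hφ h := by
  change _ = (∫ x in c.carrier, β (g.1 x) (h.1 x) ∂(Measure.euclideanHausdorffMeasure n)) -
    ∫ x in c.carrier, β (φ x) (h.1 x) ∂(Measure.euclideanHausdorffMeasure n)
  rw [← integral_sub (c.integrableOn_bilin β g h) (c.integrableOn_bilin_left β hφ h)]
  simp

end Cell

/-! ### Forms on matrices -/

section Matrices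

variable {d : ℕ}

/-- The component-wise inner product of matrices as a bilinear form. -/
def frobForm (d : ℕ) :
    Matrix (Fin d) (Fin d) ℝ →ₗ[ℝ] Matrix (Fin d) (Fin d) ℝ →ₗ[ℝ] ℝ :=
  LinearMap.mk₂ ℝ frob
    (fun A A' B => by simp [frob, add_mul, Finset.sum_add_distrib])
    (fun a A B => by simp [frob, mul_assoc, Finset.mul_sum])
    (fun A B B' => by simp [frob, mul_add, Finset.sum_add_distrib])
    (fun a A B => by simp [frob, mul_left_comm, Finset.mul_sum])

theorem frob_comm (A B : Matrix (Fin d) (Fin d) ℝ) : frob A B = frob B A := by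
  simp [frob, mul_comm]

theorem frob_self_nonneg (A : Matrix (Fin d) (Fin d) ℝ) : 0 ≤ frob A A :=
  Finset.sum_nonneg fun _ _ => Finset.sum_nonneg fun _ _ => mul_self_nonneg _

theorem frob_self_eq_zero {A : Matrix (Fin d) (Fin d) ℝ} (h : frob A A = 0) : A = 0 := by
  ext i j
  have h1 := (Finset.sum_eq_zero_iff_of_nonneg fun i _ =>
    Finset.sum_nonneg fun j _ => mul_self_nonneg (A i j)).1 h i (Finset.mem_univ i)
  have h2 := (Finset.sum_eq_zero_iff_of_nonneg fun j _ => mul_self_nonneg (A i j)).1 h1 j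
    (Finset.mem_univ j)
  simpa using h2

/-- Cauchy–Schwarz on the d diagonal entries, followed by adding the off-diagonal squares. -/
theorem trace_sq_le (A : Matrix (Fin d) (Fin d) ℝ) : A.trace ^ 2 ≤ d * frob A A := by
  have h1 : A.trace ^ 2 ≤ d * ∑ i, A i i ^ 2 := by
    have := sq_sum_le_card_mul_sum_sq (s := Finset.univ) (f := fun i => A i i)
    simpa [Matrix.trace] using this
  refine h1.trans (mul_le_mul_of_nonneg_left (Finset.sum_le_sum fun i _ => ?_) d.cast_nonneg)
  rw [sq]
  exact Finset.single_le_sum (f := fun j => A i j * A i j) (fun j _ => mul_self_nonneg _)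
    (Finset.mem_univ i)

/-- The tensor `𝒜_f` as a linear map. -/
def Material.AfLin (P : Material d) :
    Matrix (Fin d) (Fin d) ℝ →ₗ[ℝ] Matrix (Fin d) (Fin d) ℝ where
  toFun := P.Af
  map_add' A B := by
    simp only [Material.Af, Matrix.trace_add, mul_add, add_smul, ← smul_add]
    congr 1
    abel
  map_smul' a A := by
    simp only [Material.Af, Matrix.trace_smul, smul_eq_mul, RingHom.id_apply]
    rw [smul_comm a, smul_sub a, smul_smul a, mul_left_comm a]

/-- The factor 1/(dλ + 2μ) is the eigenvalue of 𝒜_f on multiples of the identity; on trace-free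
matrices it is the larger 1/(2μ). The difference of the two sides is a positive multiple of d |A|² -
(tr A)². -/
theorem Material.frob_Af_ge (P : Material d) (A : Matrix (Fin d) (Fin d) ℝ) :
    frob A A / (d * P.lam + 2 * P.mu) ≤ frob (P.Af A) A := by
  have hμ := P.mu_pos
  have hl := P.lam_pos
  have hd : (0 : ℝ) ≤ d := d.cast_nonneg
  have hD : 0 < d * P.lam + 2 * P.mu := by positivity
  have h1 : frob (1 : Matrix (Fin d) (Fin d) ℝ) A = A.trace := by
    simp [frob, Matrix.trace, Matrix.one_apply]
  have h2 : frob (P.Af A) A = (1 / (2 * P.mu)) *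
      (frob A A - (P.lam / (d * P.lam + 2 * P.mu) * A.trace) * A.trace) := by
    change frobForm d (P.Af A) A = _
    simp only [Material.Af, map_smul, map_sub, LinearMap.smul_apply, LinearMap.sub_apply,
      smul_eq_mul]
    rw [← h1]
    rfl
  have h3 := trace_sq_le A
  have h4 : frob (P.Af A) A - frob A A / (d * P.lam + 2 * P.mu) =
      P.lam / (2 * P.mu * (d * P.lam + 2 * P.mu)) * (d * frob A A - A.trace ^ 2) := by
    rw [h2]
    field_simp
    ring
  have h5 : 0 ≤ P.lam / (2 * P.mu * (d * P.lam + 2 * P.mu)) * (d * frob A A - A.trace ^ 2) :=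
    mul_nonneg (by positivity) (by linarith)
  linarith

/-- The bilinear form `(A, B) ↦ A : B` on symmetric matrices. -/
def symForm (d : ℕ) : Sym d →ₗ[ℝ] Sym d →ₗ[ℝ] ℝ :=
  (frobForm d).compl₁₂ (Sym d).subtype (Sym d).subtype

/-- The bilinear form `(A, B) ↦ 𝒜_f A : B` on symmetric matrices. -/
def Material.fluidForm (P : Material d) : Sym d →ₗ[ℝ] Sym d →ₗ[ℝ] ℝ :=
  (frobForm d).compl₁₂ (P.AfLin.comp (Sym d).subtype) (Sym d).subtype

/-- The bilinear form `(A, B) ↦ 𝒜_s A : B` on symmetric matrices. -/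
def Material.solidForm (P : Material d) : Sym d →ₗ[ℝ] Sym d →ₗ[ℝ] ℝ :=
  (frobForm d).compl₁₂ ((Sym d).subtype.comp P.C.inv) (Sym d).subtype

theorem symForm_self_nonneg (A : Sym d) : 0 ≤ symForm d A A := frob_self_nonneg _

theorem symForm_self_eq_zero (A : Sym d) (h : symForm d A A = 0) : A = 0 :=
  Subtype.ext (frob_self_eq_zero h)

theorem Material.fluidForm_self_nonneg (P : Material d) (A : Sym d) : 0 ≤ P.fluidForm A A :=
  (div_nonneg (frob_self_nonneg _)
    (by have := P.mu_pos; have := P.lam_pos; positivity)).trans (P.frob_Af_ge A)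

theorem Material.fluidForm_self_eq_zero (P : Material d) (A : Sym d) (h : P.fluidForm A A = 0) :
    A = 0 := by
  have hD : 0 < d * P.lam + 2 * P.mu := by
    have := P.mu_pos; have := P.lam_pos; positivity
  have h1 : frob (A : Matrix (Fin d) (Fin d) ℝ) A / (d * P.lam + 2 * P.mu) ≤ 0 :=
    (P.frob_Af_ge A).trans h.le
  have h2 : frob (A : Matrix (Fin d) (Fin d) ℝ) A ≤ 0 := by
    by_contra! h3
    exact absurd (div_pos h3 hD) (not_lt.2 h1)
  exact Subtype.ext (frob_self_eq_zero (h2.antisymm (frob_self_nonneg _)))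

theorem ElasticityTensor.toLin_inv (C : ElasticityTensor d) (A : Sym d) : C.toLin (C.inv A) = A :=
  (LinearEquiv.ofInjectiveEndo C.toLin C.injective).apply_symm_apply A

/-- Symmetry of 𝒞_s is evaluated at 𝒞_s⁻¹A and 𝒞_s⁻¹B; positivity of the inverse below is obtained
in the same way. -/
theorem Material.solidForm_symm (P : Material d) (A B : Sym d) :
    P.solidForm A B = P.solidForm B A := by
  have h := P.C.symm' (P.C.inv A) (P.C.inv B)
  rw [P.C.toLin_inv, P.C.toLin_inv, frob_comm] at h
  exact h.symm

theorem Material.solidForm_self_nonneg (P : Material d) (A : Sym d) : 0 ≤ P.solidForm A A := by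
  by_cases h : P.C.inv A = 0
  · simp [Material.solidForm, h]
  · have h1 := P.C.pos' _ h
    rw [P.C.toLin_inv, frob_comm] at h1
    exact h1.le

theorem Material.solidForm_self_eq_zero (P : Material d) (A : Sym d)
    (hA : P.solidForm A A = 0) : A = 0 := by
  by_contra hne
  have h : P.C.inv A ≠ 0 := fun h => hne (by rw [← P.C.toLin_inv A, h, map_zero])
  have h1 := P.C.pos' _ h
  rw [P.C.toLin_inv, frob_comm] at h1
  exact h1.ne' hA

end Matrices

theorem innerₗ_self_nonneg {d : ℕ} (x : E d) : 0 ≤ innerₗ (E d) x x :=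
  real_inner_self_nonneg (x := x)

theorem innerₗ_self_eq_zero {d : ℕ} (x : E d) (h : innerₗ (E d) x x = 0) : x = 0 :=
  inner_self_eq_zero (𝕜 := ℝ).1 h

namespace Mesh

variable {d : ℕ} {D : Domain d} (M : Mesh D)

/-! ### Regularity and finite dimension of the discrete spaces -/

theorem finiteDimensional_brokenVec (m : ℕ) : FiniteDimensional ℝ (M.brokenVec m) := by
  have := fun K => (M.elem K).finiteDimensional_elemPoly m
  let L : M.brokenVec m →ₗ[ℝ] (∀ K : Fin M.N, Fin d → (M.elem K).elemPoly m) :=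
    { toFun := fun v K i => ⟨fun x => v.1 K x i, v.2 K i⟩
      map_add' := fun _ _ => rfl
      map_smul' := fun _ _ => rfl }
  refine FiniteDimensional.of_injective L fun v w h => ?_
  ext K x i
  exact congrFun (congrArg Subtype.val (congrFun (congrFun h K) i)) x

theorem finiteDimensional_brokenSym (m : ℕ) : FiniteDimensional ℝ (M.brokenSym m) := by
  have := fun K => (M.elem K).finiteDimensional_elemPoly m
  let L : M.brokenSym m →ₗ[ℝ] (∀ K : Fin M.N, Fin d → Fin d → (M.elem K).elemPoly m) :=
    { toFun := fun v K i j => ⟨fun x => (v.1 K x : Matrix (Fin d) (Fin d) ℝ) i j, v.2 K i j⟩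
      map_add' := fun _ _ => rfl
      map_smul' := fun _ _ => rfl }
  refine FiniteDimensional.of_injective L fun v w h => ?_
  ext K x i j
  exact congrFun (congrArg Subtype.val (congrFun (congrFun (congrFun h K) i) j)) x

theorem finiteDimensional_traceVec (m : ℕ) : FiniteDimensional ℝ (M.traceVec m) := by
  have := fun F => (M.face F).finiteDimensional_facePoly m
  let L : M.traceVec m →ₗ[ℝ] (∀ F : Fin M.nF, Fin d → (M.face F).facePoly m) :=
    { toFun := fun v F i => ⟨fun x => v.1 F x i, v.2.1 F i⟩
      map_add' := fun _ _ => rfl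
      map_smul' := fun _ _ => rfl }
  refine FiniteDimensional.of_injective L fun v w h => ?_
  ext F x i
  exact congrFun (congrArg Subtype.val (congrFun (congrFun h F) i)) x

variable {m : ℕ}

theorem contDiff_brokenVec (v : M.brokenVec m) (K : Fin M.N) : ContDiff ℝ 1 (v.1 K) :=
  contDiff_euclidean.2 fun i => (M.elem K).contDiff_of_mem_elemPoly (v.2 K i)

theorem continuous_brokenSym (τ : M.brokenSym m) (K : Fin M.N) : Continuous (τ.1 K) :=
  Continuous.subtype_mk (f := fun x => (τ.1 K x : Matrix (Fin d) (Fin d) ℝ))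
    (continuous_matrix fun i j => ((M.elem K).contDiff_of_mem_elemPoly (τ.2 K i j)).continuous) _

theorem continuousOn_traceVec (v : M.traceVec m) (F : Fin M.nF) :
    ContinuousOn (v.1 F) (M.face F).carrier :=
  (PiLp.continuous_toLp 2 _).comp_continuousOn
    (continuousOn_pi.2 fun i => (M.face F).continuousOn_of_mem_facePoly (v.2.1 F i))

/-- The restriction of a piecewise polynomial vector field to an element, as a continuous function
on a set. -/
def velOn (m : ℕ) (K : Fin M.N) (S : Set (E d)) : M.brokenVec m →ₗ[ℝ] contOn S (E d) where
  toFun v := ⟨v.1 K, (M.contDiff_brokenVec v K).continuous.continuousOn⟩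
  map_add' _ _ := rfl
  map_smul' _ _ := rfl

/-- The restriction of a piecewise polynomial tensor field to an element, as a continuous function
on a set. -/
def stressOn (m : ℕ) (K : Fin M.N) (S : Set (E d)) : M.brokenSym m →ₗ[ℝ] contOn S (Sym d) where
  toFun τ := ⟨τ.1 K, (M.continuous_brokenSym τ K).continuousOn⟩
  map_add' _ _ := rfl
  map_smul' _ _ := rfl

/-- The restriction of a piecewise polynomial function on the skeleton to a face. -/
def traceOn (m : ℕ) (F : Fin M.nF) :
    M.traceVec m →ₗ[ℝ] contOn (M.face F).carrier (E d) where
  toFun v := ⟨v.1 F, M.continuousOn_traceVec v F⟩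
  map_add' _ _ := rfl
  map_smul' _ _ := rfl

/-- The strain of a piecewise polynomial vector field on an element. -/
def strainOn (m : ℕ) (K : Fin M.N) (S : Set (E d)) :
    M.brokenVec m →ₗ[ℝ] contOn S (Matrix (Fin d) (Fin d) ℝ) where
  toFun v := ⟨strain (v.1 K), by
    have h := (M.contDiff_brokenVec v K).continuous_fderiv one_ne_zero
    refine Continuous.continuousOn (continuous_matrix fun i j => ?_)
    unfold strain
    fun_prop⟩
  map_add' v w := by
    have hv := (M.contDiff_brokenVec v K).differentiable one_ne_zero
    have hw := (M.contDiff_brokenVec w K).differentiable one_ne_zero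
    ext x i j
    change strain (v.1 K + w.1 K) x i j = strain (v.1 K) x i j + strain (w.1 K) x i j
    simp only [strain, fderiv_add (hv x) (hw x)]
    simp
    ring
  map_smul' a v := by
    have hv := (M.contDiff_brokenVec v K).differentiable one_ne_zero
    ext x i j
    change strain (a • v.1 K) x i j = a * strain (v.1 K) x i j
    simp only [strain, fderiv_const_smul (hv x)]
    simp
    ring

/-- The map `A ↦ A n`. -/
def tractionLin (n : E d) : Sym d →ₗ[ℝ] E d where
  toFun A := traction A n
  map_add' A B := by
    ext i
    simp [traction, Matrix.add_mulVec]
  map_smul' a A := by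
    ext i
    simp [traction, Matrix.smul_mulVec]

/-- The normal component of a piecewise polynomial tensor field on a face of an element. -/
def tractionOn (m : ℕ) (K : Fin M.N) (F : Fin M.nF) (S : Set (E d)) :
    M.brokenSym m →ₗ[ℝ] contOn S (E d) where
  toFun τ := ⟨fun x => tractionLin (M.normal K F) (τ.1 K x),
    ((tractionLin (M.normal K F)).continuous_of_finiteDimensional.comp
      (M.continuous_brokenSym τ K)).continuousOn⟩
  map_add' τ τ' := by ext x : 2; exact map_add (tractionLin (M.normal K F)) _ _
  map_smul' a τ := by ext x : 2; exact map_smul (tractionLin (M.normal K F)) _ _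

/-- The jump on a face of an element. -/
def jumpOn (m : ℕ) (K : Fin M.N) (F : Fin M.nF) :
    M.brokenVec m × M.traceVec m →ₗ[ℝ] contOn (M.face F).carrier (E d) :=
  (M.velOn m K _).comp (LinearMap.fst ℝ _ _) - (M.traceOn m F).comp (LinearMap.snd ℝ _ _)

/-! ### The forms of the method as bilinear maps -/

theorem intK_eq (K : Fin M.N) (g : E d → ℝ) : M.intK K g =
    ∫ x in (M.elem K).carrier, g x ∂(Measure.euclideanHausdorffMeasure d) := by
  rw [EuclideanSpace.euclideanHausdorffMeasure_eq_volume]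
  rfl

/-- The weighted `L²` inner product of piecewise polynomial vector fields. -/
def velForm (m : ℕ) (w : Fin M.N → ℝ) : M.brokenVec m →ₗ[ℝ] M.brokenVec m →ₗ[ℝ] ℝ :=
  ∑ K, w K • ((M.elem K).integralForm (innerₗ (E d))).compl₁₂ (M.velOn m K _) (M.velOn m K _)

theorem velForm_apply (w : Fin M.N → ℝ) (u v : M.brokenVec m) : M.velForm m w u v =
    ∑ K, w K * M.intK K fun x => inner ℝ (u.1 K x) (v.1 K x) := by
  simp only [velForm, LinearMap.sum_apply, LinearMap.smul_apply, LinearMap.compl₁₂_apply, intK_eq]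
  rfl

theorem velForm_symm (w : Fin M.N → ℝ) (u v : M.brokenVec m) :
    M.velForm m w u v = M.velForm m w v u := by
  simp only [velForm_apply, real_inner_comm]

theorem velForm_self_nonneg {w : Fin M.N → ℝ} (hw : ∀ K, 0 ≤ w K) (u : M.brokenVec m) :
    0 ≤ M.velForm m w u u := by
  rw [velForm_apply]
  exact Finset.sum_nonneg fun K _ =>
    mul_nonneg (hw K) (integral_nonneg fun x => real_inner_self_nonneg)

/-- All summands are nonnegative, so each vanishes; then u is zero on every element and, being
polynomial there, zero as an extended function. -/
theorem velForm_self_eq_zero {w : Fin M.N → ℝ} (hw : ∀ K, 0 < w K) {u : M.brokenVec m}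
    (h : M.velForm m w u u = 0) : u = 0 := by
  have hnn : ∀ K, 0 ≤ w K * M.intK K fun x => inner ℝ (u.1 K x) (u.1 K x) := fun K =>
    mul_nonneg (hw K).le (integral_nonneg fun x => real_inner_self_nonneg)
  rw [velForm_apply, Finset.sum_eq_zero_iff_of_nonneg fun K _ => hnn K] at h
  ext K : 2
  have h1 := (mul_eq_zero.1 (h K (Finset.mem_univ K))).resolve_left (hw K).ne'
  rw [intK_eq] at h1
  have h2 := (M.elem K).eq_zero_of_integralForm_self (β := innerₗ (E d))
    innerₗ_self_nonneg innerₗ_self_eq_zero (M.velOn m K _ u) h1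
  ext x i
  exact congrFun ((M.elem K).eq_zero_of_mem_elemPoly (u.2 K i) fun x hx => by
    have h3 : u.1 K x = 0 := h2 x hx
    simp [h3]) x

/-- The integral over a family of elements of a bilinear form in two piecewise polynomial tensor
fields. -/
def stressForm (m : ℕ) (s : Finset (Fin M.N)) (β : Sym d →ₗ[ℝ] Sym d →ₗ[ℝ] ℝ) :
    M.brokenSym m →ₗ[ℝ] M.brokenSym m →ₗ[ℝ] ℝ :=
  ∑ K ∈ s, ((M.elem K).integralForm β).compl₁₂ (M.stressOn m K _) (M.stressOn m K _)

theorem stressForm_apply (s : Finset (Fin M.N)) (β : Sym d →ₗ[ℝ] Sym d →ₗ[ℝ] ℝ)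
    (σ τ : M.brokenSym m) : M.stressForm m s β σ τ =
      ∑ K ∈ s, M.intK K fun x => β (σ.1 K x) (τ.1 K x) := by
  simp only [stressForm, LinearMap.sum_apply, LinearMap.compl₁₂_apply, intK_eq]
  rfl

variable {β : Sym d →ₗ[ℝ] Sym d →ₗ[ℝ] ℝ} {s : Finset (Fin M.N)}

theorem stressForm_symm (hβ : ∀ A B, β A B = β B A) (σ τ : M.brokenSym m) :
    M.stressForm m s β σ τ = M.stressForm m s β τ σ := by
  simp only [stressForm_apply, hβ]

theorem stressForm_self_nonneg (hβ : ∀ A, 0 ≤ β A A) (σ : M.brokenSym m) :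
    0 ≤ M.stressForm m s β σ σ := by
  rw [stressForm_apply]
  exact Finset.sum_nonneg fun K _ => integral_nonneg fun x => hβ _

theorem stressForm_self_eq_zero (hβ : ∀ A, 0 ≤ β A A) (hβ0 : ∀ A, β A A = 0 → A = 0)
    {σ : M.brokenSym m} (h : M.stressForm m s β σ σ = 0) : ∀ K ∈ s, σ.1 K = 0 := by
  have hnn : ∀ K, 0 ≤ M.intK K fun x => β (σ.1 K x) (σ.1 K x) := fun K =>
    integral_nonneg fun x => hβ _
  rw [stressForm_apply, Finset.sum_eq_zero_iff_of_nonneg fun K _ => hnn K] at h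
  intro K hK
  have h1 := h K hK
  rw [intK_eq] at h1
  have h2 := (M.elem K).eq_zero_of_integralForm_self hβ hβ0 (M.stressOn m K _ σ) h1
  ext x i j
  exact congrFun ((M.elem K).eq_zero_of_mem_elemPoly (σ.2 K i j) fun x hx => by
    have h3 : σ.1 K x = 0 := h2 x hx
    simp [h3]) x

theorem stressForm_eq_zero_left {σ : M.brokenSym m} (h : ∀ K ∈ s, σ.1 K = 0) :
    M.stressForm m s β σ = 0 := by
  ext τ
  rw [stressForm_apply]
  exact Finset.sum_eq_zero fun K hK => by simp [h K hK, intK]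

/-- The form `B_h`. -/
def couplingForm (k m : ℕ) :
    M.brokenSym k →ₗ[ℝ] M.brokenVec m × M.traceVec m →ₗ[ℝ] ℝ :=
  (∑ K, ((M.elem K).integralForm ((frobForm d).comp (Sym d).subtype)).compl₁₂ (M.stressOn k K _)
    ((M.strainOn m K _).comp (LinearMap.fst ℝ _ _))) -
  ∑ K, ∑ F ∈ M.facesOf K, ((M.face F).integralForm (innerₗ (E d))).compl₁₂
    (M.tractionOn k K F _) (M.jumpOn m K F)

theorem couplingForm_apply (k : ℕ) (τ : M.brokenSym k) (v : M.brokenVec m) (vh : M.traceVec m) :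
    M.couplingForm k m τ (v, vh) = M.B τ v vh := by
  simp only [couplingForm, LinearMap.sum_apply, LinearMap.sub_apply, LinearMap.compl₁₂_apply,
    B, intK_eq]
  rfl

/-- The stabilization form. -/
def stabForm (k m : ℕ) :
    M.brokenVec m × M.traceVec m →ₗ[ℝ] M.brokenVec m × M.traceVec m →ₗ[ℝ] ℝ :=
  ∑ K, ∑ F ∈ M.facesOf K, (((k : ℝ) + 1) ^ 2 / M.hF F) •
    ((M.face F).integralForm (innerₗ (E d))).compl₁₂ (M.jumpOn m K F) (M.jumpOn m K F)

theorem stabForm_apply (k : ℕ) (u v : M.brokenVec m) (uh vh : M.traceVec m) :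
    M.stabForm k m (u, uh) (v, vh) = M.stab k u uh v vh := by
  simp only [stabForm, LinearMap.sum_apply, LinearMap.smul_apply, LinearMap.compl₁₂_apply,
    stab, pairing, intF, real_inner_smul_left, integral_const_mul]
  rfl

/-- Ensures that sums over ∂𝒯_h see every face; otherwise the penalty could not control û. -/
theorem exists_mem_facesOf (F : Fin M.nF) : ∃ K, F ∈ M.facesOf K := by
  have h : (M.face F).carrier ∈ {F | IsInteriorFace M.elem F ∨ IsBoundaryFace D.Ω M.elem F} :=
    M.face_range ▸ mem_range_self F
  have h1 : ∃ K, (M.face F).carrier ⊆ (M.elem K).carrier := by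
    rcases h with ⟨⟨K, L, -, h⟩, -⟩ | ⟨⟨K, h⟩, -⟩
    · exact ⟨K, h ▸ inter_subset_left⟩
    · exact ⟨K, h.subset⟩
  obtain ⟨K, hK⟩ := h1
  exact ⟨K, by simpa [facesOf] using hK⟩

theorem stabForm_self_nonneg (k : ℕ) (w : M.brokenVec m × M.traceVec m) :
    0 ≤ M.stabForm k m w w := by
  simp only [stabForm, LinearMap.sum_apply, LinearMap.smul_apply, LinearMap.compl₁₂_apply]
  exact Finset.sum_nonneg fun K _ => Finset.sum_nonneg fun F _ =>
    mul_nonneg (div_nonneg (by positivity) Metric.diam_nonneg)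
      ((M.face F).integralForm_self_nonneg innerₗ_self_nonneg _)

/-- With v = 0 the jump is -û, and each face carries a positive weight because h_F > 0; this is
where d ≥ 2 enters. -/
theorem stabForm_self_eq_zero (hd : 0 < d - 1) (k : ℕ) {vh : M.traceVec m}
    (h : M.stabForm k m (0, vh) (0, vh) = 0) : vh = 0 := by
  have hnn : ∀ K, ∀ F ∈ M.facesOf K, 0 ≤ (((k : ℝ) + 1) ^ 2 / M.hF F) *
      (M.face F).integralForm (innerₗ (E d)) (M.jumpOn m K F (0, vh)) (M.jumpOn m K F (0, vh)) :=
    fun K F _ => mul_nonneg (div_nonneg (by positivity) Metric.diam_nonneg)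
      ((M.face F).integralForm_self_nonneg innerₗ_self_nonneg _)
  simp only [stabForm, LinearMap.sum_apply, LinearMap.smul_apply, LinearMap.compl₁₂_apply,
    smul_eq_mul] at h
  rw [Finset.sum_eq_zero_iff_of_nonneg fun K _ => Finset.sum_nonneg (hnn K)] at h
  ext F : 2
  obtain ⟨K, hF⟩ := M.exists_mem_facesOf F
  have h1 := (Finset.sum_eq_zero_iff_of_nonneg (hnn K)).1 (h K (Finset.mem_univ K)) F hF
  have hpos : 0 < ((k : ℝ) + 1) ^ 2 / M.hF F :=
    div_pos (by positivity) ((M.face F).diam_carrier_pos hd)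
  have h2 := (M.face F).eq_zero_of_integralForm_self (β := innerₗ (E d))
    innerₗ_self_nonneg innerₗ_self_eq_zero _
    ((mul_eq_zero.1 h1).resolve_left hpos.ne')
  ext x i
  by_cases hx : x ∈ (M.face F).carrier
  · have h3 : (0 : E d) - vh.1 F x = 0 := h2 x hx
    rw [zero_sub, neg_eq_zero] at h3
    simp [h3]
  -- Off its face, a trace function is zero by the convention of extension by zero.
  · exact (vh.2.1 F i).2 x hx

/-! ### Elements and subdomains -/

theorem interior_elem_subset_solid {K : Fin M.N} (hK : K ∈ M.solid) :
    interior (M.elem K).carrier ⊆ D.Ωs := by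
  rw [← D.regular_s]
  exact interior_mono (by simpa [solid] using hK)

theorem mem_solid_or_mem_fluid (K : Fin M.N) : K ∈ M.solid ∨ K ∈ M.fluid := by
  simpa [solid, fluid] using M.aligned K

theorem interior_elem_subset (K : Fin M.N) : interior (M.elem K).carrier ⊆ D.Ω := by
  rw [← D.regular, ← D.closure_union]
  refine interior_mono ?_
  exact (M.aligned K).elim (fun h => h.trans subset_union_left) fun h => h.trans subset_union_right

theorem restrict_elem_eq {K : Fin M.N} {Ω : Set (E d)} (h : interior (M.elem K).carrier ⊆ Ω) :
    (volume.restrict Ω).restrict (M.elem K).carrier = volume.restrict (M.elem K).carrier := by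
  rw [Measure.restrict_restrict (M.elem K).isCompact_carrier.measurableSet]
  exact Measure.restrict_congr_set ((M.elem K).carrier_inter_ae_eq h)

theorem integrableOn_elem_of_memLp {G : Type*} [NormedAddCommGroup G] {K : Fin M.N}
    {Ω : Set (E d)} (h : interior (M.elem K).carrier ⊆ Ω) {g : E d → G}
    (hg : MemLp g 2 (volume.restrict Ω)) :
    IntegrableOn g (M.elem K).carrier (Measure.euclideanHausdorffMeasure d) := by
  rw [EuclideanSpace.euclideanHausdorffMeasure_eq_volume]
  have h1 := hg.restrict (M.elem K).carrier
  rw [M.restrict_elem_eq h] at h1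
  have : IsFiniteMeasure (volume.restrict (M.elem K).carrier) :=
    isFiniteMeasure_restrict.2 (M.elem K).isCompact_carrier.measure_lt_top.ne
  exact h1.integrable one_le_two

theorem integrableOn_elem_dual {K : Fin M.N} {g : E d → E d}
    (hg : MemLp g 2 (volume.restrict D.Ω)) (l : Module.Dual ℝ (E d)) :
    IntegrableOn (fun x => l (g x)) (M.elem K).carrier (Measure.euclideanHausdorffMeasure d) :=
  (LinearMap.toContinuousLinearMap l).integrable_comp
    (M.integrableOn_elem_of_memLp (M.interior_elem_subset K) hg)

end Mesh

namespace Mesh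

variable {d : ℕ} {D : Domain d} (M : Mesh D) {m : ℕ}

/-! ### Sources and projections -/

/-- The linear form `v ↦ (g, v)_{𝒯_h}`. -/
def velLoad (m : ℕ) (g : E d → E d) (hg : MemLp g 2 (volume.restrict D.Ω)) :
    M.brokenVec m →ₗ[ℝ] ℝ :=
  ∑ K, ((M.elem K).loadForm (innerₗ (E d)) g (M.integrableOn_elem_dual hg)).comp (M.velOn m K _)

theorem velLoad_apply {g : E d → E d} (hg : MemLp g 2 (volume.restrict D.Ω))
    (v : M.brokenVec m) :
    M.velLoad m g hg v = ∑ K, M.intK K fun x => inner ℝ (g x) (v.1 K x) := by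
  simp only [velLoad, LinearMap.sum_apply, LinearMap.comp_apply, intK_eq]
  rfl

/-- In this form the projection falls under the same representation lemma for symmetric forms as the
abstract equation, and differences of projections can be taken linearly. -/
theorem isVelProj_iff {g : E d → E d} (hg : MemLp g 2 (volume.restrict D.Ω))
    (w : M.brokenVec m) : IsVelProj M g w ↔ M.velForm m 1 w = M.velLoad m g hg := by
  have h : ∀ v : M.brokenVec m, ∑ K, M.intK K (fun x => inner ℝ (w.1 K x - g x) (v.1 K x)) =
      M.velForm m 1 w v - M.velLoad m g hg v := fun v => by
    simp only [velForm, velLoad, LinearMap.sum_apply,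
      LinearMap.compl₁₂_apply, LinearMap.comp_apply, Pi.one_apply, one_smul, intK_eq]
    rw [← Finset.sum_sub_distrib]
    exact Finset.sum_congr rfl fun K _ => (M.elem K).integral_sub_left (innerₗ (E d))
      (M.integrableOn_elem_dual hg) (M.velOn m K _ w) (M.velOn m K _ v)
  unfold IsVelProj
  simp only [h, sub_eq_zero, LinearMap.ext_iff]

theorem exists_isVelProj {g : E d → E d} (hg : MemLp g 2 (volume.restrict D.Ω)) :
    ∃ w : M.brokenVec m, IsVelProj M g w := by
  have := M.finiteDimensional_brokenVec m
  obtain ⟨w, hw⟩ := exists_represents_of_symm (M.velForm_symm (m := m) 1) (M.velLoad m g hg)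
    fun z hz => by
      rw [M.velForm_self_eq_zero (w := 1) (fun _ => one_pos) (u := z) (by rw [hz]; rfl), map_zero]
  exact ⟨w, (M.isVelProj_iff hg w).2 hw⟩

theorem integrableOn_solid_dual {K : Fin M.N} (hK : K ∈ M.solid) {σ₀ : E d → Sym d}
    (hσ₀ : ∀ i j, MemLp (fun x => (σ₀ x : Matrix (Fin d) (Fin d) ℝ) i j) 2
      (volume.restrict D.Ωs)) (l : Module.Dual ℝ (Sym d)) :
    IntegrableOn (fun x => l (σ₀ x)) (M.elem K).carrier
      (Measure.euclideanHausdorffMeasure d) := by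
  obtain ⟨L, rfl⟩ := LinearMap.exists_extend l
  have h : ∀ A : Matrix (Fin d) (Fin d) ℝ, L A = ∑ i, ∑ j, A i j * L (Matrix.single i j 1) := by
    intro A
    conv_lhs => rw [Matrix.matrix_eq_sum_single A]
    simp only [map_sum]
    refine Finset.sum_congr rfl fun i _ => Finset.sum_congr rfl fun j _ => ?_
    rw [← smul_eq_mul, ← map_smul, Matrix.smul_single, smul_eq_mul, mul_one]
  rw [show (fun x => (L.comp (Sym d).subtype) (σ₀ x)) = fun x => ∑ i, ∑ j,
    (σ₀ x : Matrix (Fin d) (Fin d) ℝ) i j * L (Matrix.single i j 1) from funext fun x => h (σ₀ x)]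
  exact integrable_finsetSum _ fun i _ => integrable_finsetSum _ fun j _ =>
    (M.integrableOn_elem_of_memLp (M.interior_elem_subset_solid hK) (hσ₀ i j)).mul_const _

theorem exists_stressLoad (m : ℕ) {σ₀ : E d → Sym d}
    (hσ₀ : ∀ i j, MemLp (fun x => (σ₀ x : Matrix (Fin d) (Fin d) ℝ) i j) 2
      (volume.restrict D.Ωs)) :
    ∃ L : M.brokenSym m →ₗ[ℝ] ℝ,
      (∀ τ : M.brokenSym m, (∀ K ∈ M.solid, τ.1 K = 0) → L τ = 0) ∧
      ∀ ς : M.brokenSym m, IsStressProj M σ₀ ς ↔ M.stressForm m M.solid (symForm d) ς = L := by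
  -- The sum runs over `attach` because σ₀ is square integrable only on Ω_s, so integrability on K
  -- needs the membership of K in the solid.
  let L : M.brokenSym m →ₗ[ℝ] ℝ := ∑ K ∈ M.solid.attach,
    ((M.elem K).loadForm (symForm d) σ₀ (M.integrableOn_solid_dual K.2 hσ₀)).comp
      (M.stressOn m K _)
  have h : ∀ ς τ : M.brokenSym m, ∑ K ∈ M.solid, M.intK K (fun x =>
      frob ((ς.1 K x - σ₀ x : Sym d) : Matrix (Fin d) (Fin d) ℝ) (τ.1 K x)) =
      M.stressForm m M.solid (symForm d) ς τ - L τ := fun ς τ => by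
    simp only [stressForm, L, LinearMap.sum_apply, LinearMap.compl₁₂_apply, LinearMap.comp_apply,
      intK_eq]
    rw [← Finset.sum_attach M.solid, ← Finset.sum_attach M.solid, ← Finset.sum_sub_distrib]
    exact Finset.sum_congr rfl fun K _ => (M.elem K).integral_sub_left (symForm d)
      (M.integrableOn_solid_dual K.2 hσ₀) (M.stressOn m K _ ς) (M.stressOn m K _ τ)
  refine ⟨L, fun τ hτ => ?_, fun ς => ?_⟩
  · simp only [L, LinearMap.sum_apply, LinearMap.comp_apply]
    refine Finset.sum_eq_zero fun K _ => ?_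
    have h0 : M.stressOn m K (M.elem K).carrier τ = 0 := Subtype.ext (hτ K K.2)
    rw [h0, map_zero]
  · unfold IsStressProj
    simp only [h, sub_eq_zero, LinearMap.ext_iff]

theorem exists_isStressProj {σ₀ : E d → Sym d}
    (hσ₀ : ∀ i j, MemLp (fun x => (σ₀ x : Matrix (Fin d) (Fin d) ℝ) i j) 2
      (volume.restrict D.Ωs)) :
    ∃ ς : M.brokenSym m, IsStressProj M σ₀ ς := by
  have := M.finiteDimensional_brokenSym m
  obtain ⟨L, hL0, hL⟩ := M.exists_stressLoad m hσ₀
  obtain ⟨ς, hς⟩ := exists_represents_of_symm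
    (M.stressForm_symm (m := m) (s := M.solid) (β := symForm d) fun A B => frob_comm _ _) L
    fun z hz => hL0 z (M.stressForm_self_eq_zero symForm_self_nonneg symForm_self_eq_zero
      (by rw [hz]; rfl))
  exact ⟨ς, (hL ς).2 hς⟩

/-- The representative is v restricted to K and extended by zero. Hence the load depends
continuously on the source in L², and so on t. -/
theorem exists_inner_eq_intK (v : M.brokenVec m) (K : Fin M.N) :
    ∃ w : Lp (E d) 2 (volume.restrict D.Ω), ∀ φ : Lp (E d) 2 (volume.restrict D.Ω),
      (M.intK K fun x => inner ℝ (φ x) (v.1 K x)) = inner ℝ φ w := by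
  set S := (M.elem K).carrier
  have hS : MeasurableSet S := (M.elem K).isCompact_carrier.measurableSet
  have hr := M.restrict_elem_eq (M.interior_elem_subset K)
  have hv : MemLp (S.indicator (v.1 K)) 2 (volume.restrict D.Ω) := by
    rw [memLp_indicator_iff_restrict hS, hr]
    have : IsFiniteMeasure (volume.restrict S) :=
      isFiniteMeasure_restrict.2 (M.elem K).isCompact_carrier.measure_lt_top.ne
    have hc := (M.contDiff_brokenVec v K).continuous
    obtain ⟨C, hC⟩ := (M.elem K).isCompact_carrier.exists_bound_of_continuousOn hc.continuousOn
    exact MemLp.of_bound hc.aestronglyMeasurable C (ae_restrict_of_forall_mem hS hC)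
  obtain ⟨w, hw⟩ : ∃ w : Lp (E d) 2 (volume.restrict D.Ω),
    w =ᵐ[volume.restrict D.Ω] S.indicator (v.1 K) := ⟨_, hv.coeFn_toLp⟩
  refine ⟨w, fun φ => ?_⟩
  rw [L2.inner_def]
  have h1 : ∫ x, inner ℝ (φ x) (w x) ∂(volume.restrict D.Ω) =
      ∫ x, S.indicator (fun x => inner ℝ (φ x) (v.1 K x)) x ∂(volume.restrict D.Ω) := by
    refine integral_congr_ae ?_
    filter_upwards [hw] with x hx
    rw [hx]
    by_cases hxS : x ∈ S <;> simp [hxS]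
  rw [h1, integral_indicator hS, hr]
  rfl

theorem continuousOn_velLoad {T : ℝ} {f : ℝ → Lp (E d) 2 (volume.restrict D.Ω)}
    (hf : ContinuousOn f (Icc 0 T)) (v : M.brokenVec m) :
    ContinuousOn (fun t => M.velLoad m (f t) (Lp.memLp (f t)) v) (Icc 0 T) := by
  simp only [velLoad_apply]
  refine continuousOn_finsetSum _ fun K _ => ?_
  obtain ⟨w, hw⟩ := M.exists_inner_eq_intK v K
  simp only [hw]
  exact hf.inner continuousOn_const

/-! ### The semi-discrete problem as a differential-algebraic equation -/

/-- The space of triples `(σ, (u, û))`. -/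
abbrev StateSpace (k : ℕ) : Type :=
  M.brokenSym k × M.brokenVec (k + 1) × M.traceVec (k + 1)

open Classical in
/-- The density of the material in the element `K`. -/
def density (P : Material d) (K : Fin M.N) : ℝ := if K ∈ M.solid then P.rhoS else P.rhoF

theorem density_pos (P : Material d) (K : Fin M.N) : 0 < M.density P K := by
  unfold density
  split_ifs
  exacts [P.rhoS_pos, P.rhoF_pos]

/-- The form multiplying the time derivatives. -/
def inertiaForm (P : Material d) (k : ℕ) :
    M.StateSpace k →ₗ[ℝ] M.StateSpace k →ₗ[ℝ] ℝ :=
  (M.velForm (k + 1) (M.density P)).compl₁₂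
      ((LinearMap.fst ℝ _ _).comp (LinearMap.snd ℝ _ _))
      ((LinearMap.fst ℝ _ _).comp (LinearMap.snd ℝ _ _)) +
    (M.stressForm k M.solid P.solidForm).compl₁₂ (LinearMap.fst ℝ _ _) (LinearMap.fst ℝ _ _)

/-- The form without time derivatives. -/
def evolutionForm (P : Material d) (k : ℕ) :
    M.StateSpace k →ₗ[ℝ] M.StateSpace k →ₗ[ℝ] ℝ :=
  (M.stressForm k M.fluid P.fluidForm).compl₁₂ (LinearMap.fst ℝ _ _) (LinearMap.fst ℝ _ _) +
    (M.couplingForm k (k + 1)).compl₁₂ (LinearMap.fst ℝ _ _) (LinearMap.snd ℝ _ _) -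
    (M.couplingForm k (k + 1)).flip.compl₁₂ (LinearMap.snd ℝ _ _) (LinearMap.fst ℝ _ _) +
    (M.stabForm k (k + 1)).compl₁₂ (LinearMap.snd ℝ _ _) (LinearMap.snd ℝ _ _)

theorem inertiaForm_apply (P : Material d) (k : ℕ) (x y : M.StateSpace k) :
    M.inertiaForm P k x y = M.massU P x.2.1 y.2.1 + M.formS P x.1 y.1 := by
  simp only [inertiaForm, LinearMap.add_apply, LinearMap.compl₁₂_apply, LinearMap.comp_apply,
    LinearMap.fst_apply, LinearMap.snd_apply, velForm_apply, stressForm_apply]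
  rfl

theorem evolutionForm_apply (P : Material d) (k : ℕ) (x y : M.StateSpace k) :
    M.evolutionForm P k x y = M.formF P x.1 y.1 + M.B x.1 y.2.1 y.2.2 - M.B y.1 x.2.1 x.2.2 +
      M.stab k x.2.1 x.2.2 y.2.1 y.2.2 := by
  simp only [evolutionForm, LinearMap.add_apply, LinearMap.sub_apply, LinearMap.compl₁₂_apply,
    LinearMap.fst_apply, LinearMap.snd_apply, LinearMap.flip_apply, stressForm_apply,
    ← couplingForm_apply, ← stabForm_apply]
  rfl

theorem inertiaForm_symm (P : Material d) (k : ℕ) (x y : M.StateSpace k) :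
    M.inertiaForm P k x y = M.inertiaForm P k y x := by
  simp only [inertiaForm, LinearMap.add_apply, LinearMap.compl₁₂_apply]
  rw [M.velForm_symm, M.stressForm_symm P.solidForm_symm]

/-- The diagonal of the form is a sum of two nonnegative energies, so both vanish. Nothing is
imposed on the fluid stress or on û. -/
theorem inertiaForm_eq_zero_iff (P : Material d) (k : ℕ) (z : M.StateSpace k) :
    M.inertiaForm P k z = 0 ↔ z.2.1 = 0 ∧ ∀ K ∈ M.solid, z.1.1 K = 0 := by
  constructor
  · intro h
    have h1 : M.velForm (k + 1) (M.density P) z.2.1 z.2.1 +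
        M.stressForm k M.solid P.solidForm z.1 z.1 = 0 := LinearMap.congr_fun h z
    have h2 := M.velForm_self_nonneg (fun K => (M.density_pos P K).le) z.2.1
    have h3 := M.stressForm_self_nonneg (s := M.solid) P.solidForm_self_nonneg z.1
    exact ⟨M.velForm_self_eq_zero (M.density_pos P) (by linarith),
      M.stressForm_self_eq_zero P.solidForm_self_nonneg P.solidForm_self_eq_zero (by linarith)⟩
  · rintro ⟨h1, h2⟩
    refine LinearMap.ext fun y => ?_
    simp only [inertiaForm, LinearMap.add_apply, LinearMap.compl₁₂_apply, LinearMap.comp_apply,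
      LinearMap.fst_apply, LinearMap.snd_apply, h1, M.stressForm_eq_zero_left h2]
    simp

/-- The coupling is skew and cancels on the diagonal. What remains is the fluid energy plus the
penalty: the first kills σ in the fluid, the kernel condition kills it in the solid, and the penalty
kills û. -/
theorem evolutionForm_definite (hd : 0 < d - 1) (P : Material d) (k : ℕ) (z : M.StateSpace k)
    (hz : M.inertiaForm P k z = 0) (h : M.evolutionForm P k z z = 0) : z = 0 := by
  obtain ⟨hu, hs⟩ := (M.inertiaForm_eq_zero_iff P k z).1 hz
  obtain ⟨σ, u, uh⟩ := z
  obtain rfl : u = 0 := hu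
  have h1 : M.stressForm k M.fluid P.fluidForm σ σ + M.couplingForm k (k + 1) σ (0, uh) -
      M.couplingForm k (k + 1) σ (0, uh) + M.stabForm k (k + 1) (0, uh) (0, uh) = 0 := h
  have h2 := M.stressForm_self_nonneg (s := M.fluid) P.fluidForm_self_nonneg σ
  have h3 := M.stabForm_self_nonneg k ((0 : M.brokenVec (k + 1)), uh)
  have hf := M.stressForm_self_eq_zero (s := M.fluid) (σ := σ) P.fluidForm_self_nonneg
    P.fluidForm_self_eq_zero (by linarith)
  have hσ : σ = 0 := by
    ext K : 2
    exact (M.mem_solid_or_mem_fluid K).elim (hs K) (hf K)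
  rw [hσ, M.stabForm_self_eq_zero hd k (vh := uh) (by linarith)]
  rfl

/-- The source of the system as a linear form on the triples. -/
def sourceForm (k : ℕ) (φ : Lp (E d) 2 (volume.restrict D.Ω)) : Module.Dual ℝ (M.StateSpace k) :=
  (M.velLoad (k + 1) φ (Lp.memLp φ)).comp ((LinearMap.fst ℝ _ _).comp (LinearMap.snd ℝ _ _))

/-- The load tests only the component v, which is zero on the kernel. The algebraic constraints are
therefore homogeneous and independent of time. -/
theorem sourceForm_eq_zero (P : Material d) (k : ℕ) (φ : Lp (E d) 2 (volume.restrict D.Ω))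
    (z : M.StateSpace k) (hz : M.inertiaForm P k z = 0) : M.sourceForm k φ z = 0 := by
  change M.velLoad (k + 1) φ (Lp.memLp φ) z.2.1 = 0
  rw [((M.inertiaForm_eq_zero_iff P k z).1 hz).1, map_zero]

end Mesh

/-! ### Solvability, uniqueness and consistent initial data -/

variable {d : ℕ} {D : Domain d}

theorem isSolution_iff (M : Mesh D) (P : Material d) (k : ℕ) (T : ℝ)
    (f : ℝ → Lp (E d) 2 (volume.restrict D.Ω))
    (σ : ℝ → M.brokenSym k) (u : ℝ → M.brokenVec (k + 1)) (uh : ℝ → M.traceVec (k + 1)) :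
    IsSolution M P k T f σ u uh ↔ ∃ x' : ℝ → M.StateSpace k,
      IsC1Curve T (fun t => (σ t, u t, uh t)) x' ∧
      ∀ t ∈ Icc 0 T, ∀ y, M.inertiaForm P k (x' t) y +
        M.evolutionForm P k (σ t, u t, uh t) y = M.sourceForm k (f t) y := by
  have key : ∀ (t : ℝ) (x' : M.StateSpace k) (y : M.StateSpace k),
      (M.inertiaForm P k x' y + M.evolutionForm P k (σ t, u t, uh t) y = M.sourceForm k (f t) y ↔
      M.massU P x'.2.1 y.2.1 + M.formS P x'.1 y.1 + M.formF P (σ t) y.1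
        + M.B (σ t) y.2.1 y.2.2 - M.B y.1 (u t) (uh t) + M.stab k (u t) (uh t) y.2.1 y.2.2
      = ∑ K, M.intK K fun x => inner ℝ (f t x) (y.2.1.1 K x)) := fun t x' y => by
    have h : M.sourceForm k (f t) y = ∑ K, M.intK K fun x => inner ℝ (f t x) (y.2.1.1 K x) :=
      M.velLoad_apply _ _
    rw [h, M.inertiaForm_apply, M.evolutionForm_apply, ← add_assoc, ← add_sub_assoc, ← add_assoc]
  constructor
  · rintro ⟨σ', u', uh', hσ, hu, huh, h⟩
    exact ⟨_, hσ.prodMk (hu.prodMk huh), fun t ht y => (key t _ y).2 (h t ht y.1 y.2.1 y.2.2)⟩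
  · rintro ⟨x', hx, h⟩
    exact ⟨fun t => (x' t).1, fun t => (x' t).2.1, fun t => (x' t).2.2,
      hx.map (LinearMap.fst ℝ _ _),
      hx.map ((LinearMap.fst ℝ _ _).comp (LinearMap.snd ℝ _ _)),
      hx.map ((LinearMap.snd ℝ _ _).comp (LinearMap.snd ℝ _ _)),
      fun t ht τ v vh => (key t (x' t) (τ, v, vh)).1 (h t ht _)⟩

/-- The test functions (τ, 0, v̂) with τ = 0 in the solid are exactly the kernel of the inertia
form. -/
theorem isConsistentData_iff (M : Mesh D) (P : Material d) (k : ℕ) (u₀ : E d → E d)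
    (σ₀ : E d → Sym d) (u₀h : Fin M.nF → E d → E d) :
    IsConsistentData M P k u₀ σ₀ u₀h ↔
      ∃ x : M.StateSpace k, x ∈ constraintSpace (M.inertiaForm P k) (M.evolutionForm P k) ∧
        IsStressProj M σ₀ x.1 ∧ IsVelProj M u₀ x.2.1 ∧ IsTraceProj M u₀h x.2.2 := by
  constructor
  · rintro ⟨ς, w, wh, h1, h2, h3, h⟩
    refine ⟨(ς, w, wh), fun z hz => ?_, h1, h2, h3⟩
    obtain ⟨hz1, hz2⟩ := (M.inertiaForm_eq_zero_iff P k z).1 hz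
    rw [M.evolutionForm_apply, hz1]
    exact h z.1 z.2.2 hz2
  · rintro ⟨⟨ς, w, wh⟩, hx, h1, h2, h3⟩
    refine ⟨ς, w, wh, h1, h2, h3, fun τ vh hτ => ?_⟩
    have h := hx (τ, 0, vh) ((M.inertiaForm_eq_zero_iff P k _).2 ⟨rfl, hτ⟩)
    rwa [M.evolutionForm_apply] at h

theorem exists_isSolution_of_mem_constraintSpace (hd : 0 < d - 1) (M : Mesh D) (P : Material d)
    (k : ℕ) {T : ℝ} (hT : 0 ≤ T) {f : ℝ → Lp (E d) 2 (volume.restrict D.Ω)}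
    (hf : ContinuousOn f (Icc 0 T)) (x₀ : M.StateSpace k)
    (hx₀ : x₀ ∈ constraintSpace (M.inertiaForm P k) (M.evolutionForm P k)) :
    ∃ σ u uh, IsSolution M P k T f σ u uh ∧ σ 0 = x₀.1 ∧ u 0 = x₀.2.1 ∧ uh 0 = x₀.2.2 := by
  have := M.finiteDimensional_brokenSym k
  have := M.finiteDimensional_brokenVec (k + 1)
  have := M.finiteDimensional_traceVec (k + 1)
  obtain ⟨x, x', h0, hC, hx⟩ := exists_dae_solution hT (M.inertiaForm_symm P k)
    (M.evolutionForm_definite hd P k) (f := fun t => M.sourceForm k (f t))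
    (fun y => M.continuousOn_velLoad hf y.2.1) (fun t => M.sourceForm_eq_zero P k (f t)) hx₀
  exact ⟨fun t => (x t).1, fun t => (x t).2.1, fun t => (x t).2.2,
    (isSolution_iff M P k T f _ _ _).2 ⟨x', hC, hx⟩,
    congrArg (fun x => x.1) h0, congrArg (fun x => x.2.1) h0, congrArg (fun x => x.2.2) h0⟩

theorem exists_mem_constraintSpace_isProj (hd : 0 < d - 1) (M : Mesh D) (P : Material d) (k : ℕ)
    {u₀ : E d → E d} (hu₀ : MemLp u₀ 2 (volume.restrict D.Ω)) {σ₀ : E d → Sym d}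
    (hσ₀ : ∀ i j, MemLp (fun x => (σ₀ x : Matrix (Fin d) (Fin d) ℝ) i j) 2
      (volume.restrict D.Ωs)) :
    ∃ x : M.StateSpace k, x ∈ constraintSpace (M.inertiaForm P k) (M.evolutionForm P k) ∧
      IsVelProj M u₀ x.2.1 ∧ IsStressProj M σ₀ x.1 := by
  have := M.finiteDimensional_brokenSym k
  have := M.finiteDimensional_brokenVec (k + 1)
  have := M.finiteDimensional_traceVec (k + 1)
  obtain ⟨L, -, hL⟩ := M.exists_stressLoad k hσ₀
  obtain ⟨w, hw⟩ := M.exists_isVelProj (m := k + 1) hu₀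
  obtain ⟨ς, hς⟩ := M.exists_isStressProj (m := k) hσ₀
  -- The trace 0 is an arbitrary start: the correction z changes only the fluid stress and the
  -- trace, so both projections survive.
  obtain ⟨z, hz, hmem⟩ := exists_sub_mem_constraintSpace (M.evolutionForm_definite hd P k)
    ((ς, w, 0) : M.StateSpace k)
  obtain ⟨hz1, hz2⟩ := (M.inertiaForm_eq_zero_iff P k z).1 hz
  refine ⟨_, hmem, ?_, ?_⟩
  · have h1 : ((ς, w, 0) - z : M.StateSpace k).2.1 = w := by
      rw [Prod.snd_sub, Prod.fst_sub, hz1, sub_zero]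
    rwa [h1]
  · refine (hL (ς - z.1)).2 ?_
    have h1 := LinearMap.map_sub (M.stressForm k M.solid (symForm d)) ς z.1
    refine h1.trans ?_
    rw [M.stressForm_eq_zero_left hz2, sub_zero]
    exact (hL ς).1 hς

/-- The projections are unweighted while the inertia form carries ρ and 𝒜_s, but the kernels match:
a difference of two admissible states has u = 0 and σ = 0 in the solid. -/
theorem inertiaForm_eq_of_isProj (M : Mesh D) (P : Material d) (k : ℕ)
    {u₀ : E d → E d} (hu₀ : MemLp u₀ 2 (volume.restrict D.Ω)) {σ₀ : E d → Sym d}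
    (hσ₀ : ∀ i j, MemLp (fun x => (σ₀ x : Matrix (Fin d) (Fin d) ℝ) i j) 2
      (volume.restrict D.Ωs)) (x y : M.StateSpace k)
    (hxu : IsVelProj M u₀ x.2.1) (hxσ : IsStressProj M σ₀ x.1)
    (hyu : IsVelProj M u₀ y.2.1) (hyσ : IsStressProj M σ₀ y.1) :
    M.inertiaForm P k x = M.inertiaForm P k y := by
  obtain ⟨L, -, hL⟩ := M.exists_stressLoad k hσ₀
  rw [M.isVelProj_iff hu₀] at hxu hyu
  rw [hL] at hxσ hyσ
  have hu0 : M.velForm (k + 1) 1 (x.2.1 - y.2.1) = 0 := by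
    rw [LinearMap.map_sub, hxu, hyu, sub_self]
  have hσ0 : M.stressForm k M.solid (symForm d) (x.1 - y.1) = 0 :=
    (LinearMap.map_sub _ x.1 y.1).trans (by rw [hxσ, hyσ, sub_self])
  have h1 := M.velForm_self_eq_zero (w := 1) (fun _ => one_pos)
    (LinearMap.congr_fun hu0 (x.2.1 - y.2.1))
  have h2 := M.stressForm_self_eq_zero symForm_self_nonneg symForm_self_eq_zero
    (LinearMap.congr_fun hσ0 (x.1 - y.1))
  have h3 : M.inertiaForm P k (x - y) = 0 := (M.inertiaForm_eq_zero_iff P k _).2 ⟨h1, h2⟩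
  exact sub_eq_zero.1 ((LinearMap.map_sub (M.inertiaForm P k) x y).symm.trans h3)

theorem IsSolution.eqOn (hd : 0 < d - 1) {M : Mesh D} {P : Material d} {k : ℕ} {T : ℝ}
    {f : ℝ → Lp (E d) 2 (volume.restrict D.Ω)}
    {σ σ₂ : ℝ → M.brokenSym k} {u u₂ : ℝ → M.brokenVec (k + 1)} {uh uh₂ : ℝ → M.traceVec (k + 1)}
    (h : IsSolution M P k T f σ u uh) (h₂ : IsSolution M P k T f σ₂ u₂ uh₂)
    (h0 : M.inertiaForm P k (σ 0, u 0, uh 0) = M.inertiaForm P k (σ₂ 0, u₂ 0, uh₂ 0)) :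
    EqOn σ σ₂ (Icc 0 T) ∧ EqOn u u₂ (Icc 0 T) ∧ EqOn uh uh₂ (Icc 0 T) := by
  have := M.finiteDimensional_brokenSym k
  have := M.finiteDimensional_brokenVec (k + 1)
  have := M.finiteDimensional_traceVec (k + 1)
  obtain ⟨x', hC, hx⟩ := (isSolution_iff M P k T f _ _ _).1 h
  obtain ⟨x₂', hC₂, hx₂⟩ := (isSolution_iff M P k T f _ _ _).1 h₂
  have heq := dae_unique (M.inertiaForm_symm P k) (M.evolutionForm_definite hd P k)
    (f := fun t => M.sourceForm k (f t)) (fun t => M.sourceForm_eq_zero P k (f t))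
    hC hC₂ hx hx₂ h0
  exact ⟨fun t ht => congrArg (fun x => x.1) (heq ht),
    fun t ht => congrArg (fun x => x.2.1) (heq ht),
    fun t ht => congrArg (fun x => x.2.2) (heq ht)⟩

/-- At t = 0 this is the necessity of the consistency condition. -/
theorem IsSolution.mem_constraintSpace {M : Mesh D} {P : Material d} {k : ℕ} {T : ℝ}
    {f : ℝ → Lp (E d) 2 (volume.restrict D.Ω)} {σ : ℝ → M.brokenSym k}
    {u : ℝ → M.brokenVec (k + 1)} {uh : ℝ → M.traceVec (k + 1)}
    (h : IsSolution M P k T f σ u uh) {t : ℝ} (ht : t ∈ Icc 0 T) :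
    ((σ t, u t, uh t) : M.StateSpace k) ∈
      constraintSpace (M.inertiaForm P k) (M.evolutionForm P k) := by
  obtain ⟨x', -, hx⟩ := (isSolution_iff M P k T f _ _ _).1 h
  exact dae_mem_constraintSpace (M.inertiaForm_symm P k) (f := fun t => M.sourceForm k (f t))
    (x := fun t => ((σ t, u t, uh t) : M.StateSpace k))
    (fun t => M.sourceForm_eq_zero P k (f t)) hx ht

end FSI

end

theorem mainTheorem4 {d : ℕ} (hd : d = 2 ∨ d = 3) (D : FSI.Domain d) (M : FSI.Mesh D)
    (P : FSI.Material d) (k : ℕ) (T : ℝ) (hT : 0 < T)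
    (f : ℝ → Lp (FSI.E d) 2 (volume.restrict D.Ω)) (hf : ContinuousOn f (Icc 0 T))
    (u₀ : FSI.E d → FSI.E d) (hu₀ : MemLp u₀ 2 (volume.restrict D.Ω))
    (σ₀ : FSI.E d → FSI.Sym d)
    (hσ₀ : ∀ i j, MemLp (fun x => (σ₀ x : Matrix (Fin d) (Fin d) ℝ) i j) 2
      (volume.restrict D.Ωs)) :
    (∃ σ u uh, FSI.IsSolution M P k T f σ u uh ∧
      FSI.IsVelProj M u₀ (u 0) ∧ FSI.IsStressProj M σ₀ (σ 0)) ∧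
    (∀ σ u uh σ₂ u₂ uh₂,
      FSI.IsSolution M P k T f σ u uh →
      FSI.IsVelProj M u₀ (u 0) → FSI.IsStressProj M σ₀ (σ 0) →
      FSI.IsSolution M P k T f σ₂ u₂ uh₂ →
      FSI.IsVelProj M u₀ (u₂ 0) → FSI.IsStressProj M σ₀ (σ₂ 0) →
      EqOn σ σ₂ (Icc 0 T) ∧ EqOn u u₂ (Icc 0 T) ∧ EqOn uh uh₂ (Icc 0 T)) ∧
    (∀ u₀h : Fin M.nF → FSI.E d → FSI.E d,
      (∀ F, MemLp (u₀h F) 2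
        ((Measure.euclideanHausdorffMeasure (d - 1)).restrict (M.face F).carrier)) →
      ((∃ σ u uh, FSI.IsSolution M P k T f σ u uh ∧
          FSI.IsVelProj M u₀ (u 0) ∧ FSI.IsStressProj M σ₀ (σ 0) ∧
          FSI.IsTraceProj M u₀h (uh 0)) ↔
        FSI.IsConsistentData M P k u₀ σ₀ u₀h)) := by
  have hd' : 0 < d - 1 := by omega
  refine ⟨?_, ?_, fun u₀h _ => ?_⟩
  · obtain ⟨x₀, hx₀, hu, hσ⟩ := FSI.exists_mem_constraintSpace_isProj hd' M P k hu₀ hσ₀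
    obtain ⟨σ, u, uh, hsol, h1, h2, -⟩ :=
      FSI.exists_isSolution_of_mem_constraintSpace hd' M P k hT.le hf x₀ hx₀
    exact ⟨σ, u, uh, hsol, h2 ▸ hu, h1 ▸ hσ⟩
  · intro σ u uh σ₂ u₂ uh₂ h hu hσ h₂ hu₂ hσ₂
    exact h.eqOn hd' h₂ (FSI.inertiaForm_eq_of_isProj M P k hu₀ hσ₀ (σ 0, u 0, uh 0)
      (σ₂ 0, u₂ 0, uh₂ 0) hu hσ hu₂ hσ₂)
  · rw [FSI.isConsistentData_iff]
    constructor
    · rintro ⟨σ, u, uh, h, hu, hσ, huh⟩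
      exact ⟨(σ 0, u 0, uh 0), h.mem_constraintSpace ⟨le_rfl, hT.le⟩, hσ, hu, huh⟩
    -- Consistent data are a point of the constraint space, from which the evolution can start
    -- without correction, so û(0) is kept.
    · rintro ⟨x₀, hx₀, hσ, hu, huh⟩
      obtain ⟨σ, u, uh, hsol, h1, h2, h3⟩ :=
        FSI.exists_isSolution_of_mem_constraintSpace hd' M P k hT.le hf x₀ hx₀
      exact ⟨σ, u, uh, hsol, h2 ▸ hu, h1 ▸ hσ, h3 ▸ huh⟩
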